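/- Let $D$ be an integral domain with quotient field $K$. For a nonzero fractional ideal $A$ of $D$ put $A^{-1}=\{x\in K\mid xA\subseteq D\}$, $A_v=(A^{-1})^{-1}$ and $A_t=\bigcup\{J_v\mid J\subseteq A \text{ a nonzero finitely generated fractional ideal of } D\}$. A $t$-ideal is a nonzero ideal $I\subseteq D$ with $I_t=I$; a maximal $t$-ideal is one that is maximal among the proper $t$-ideals; a nonzero ideal $I$ is $t$-invertible if $(II^{-1})_t=D$. An ideal $I$ of $D$ is a valuation ideal if $IV\cap D=I$ for some valuation ring $V$ with $D\subseteq V\subseteq K$. Suppose that $D$ is a $t$-VIFD, i.e., for every nonzero $a\in D$ there are $n\ge 1$ and valuation ideals $I_1,\dots,I_n$ of $D$ with $aD=(I_1\cdots I_n)_t$. Then the following statements are equivalent. 1. $D$ is a generalized Krull domain, i.e., every nonzero finitely generated ideal of $D$ is $t$-invertible ($D$ is a P$v$MD), $t\text{-}\dim(D)\le 1$, and every nonzero nonunit of $D$ lies in only finitely many maximal $t$-ideals. 2. $t\text{-}\dim(D)\le 1$, where $t\text{-}\dim(D)$ is the supremum of all integers $n\ge 0$ for which there is a chain $P_1\subsetneq\cdots\subsetneq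 P_n$ of (nonzero) prime $t$-ideals of $D$. 3. $D$ satisfies the Principal Ideal Theorem, i.e., every prime ideal minimal over a nonzero principal ideal of $D$ has height one. 4. $D$ is completely integrally closed, i.e., if $x\in K$ and there is a nonzero $c\in D$ with $cx^n\in D$ for all $n\ge 1$, then $x\in D$. 5. $\bigcap_{n\ge 1}(I^n)_t=(0)$ for each proper $t$-invertible $t$-ideal $I$ of $D$. -/

import Mathlib

namespace TVIFD

open scoped nonZeroDivisors

noncomputable section

variable {D : Type*} [CommRing D] [IsDomain D]
variable (K : Type*) [Field K] [Algebra D K] [IsFractionRing D K]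

/-! Fractional ideals are Mathlib's `FractionalIdeal D⁰ K`, with `A⁻¹ = (D : A)` for `A ≠ 0` and the
convention `0⁻¹ = 0`. A nonzero fractional ideal is an element of `F(D)`. -/

variable {K} in
/-- The divisorial closure `A_v = (A⁻¹)⁻¹`. The convention for zero gives `0_v = 0`. -/
def vClosure (A : FractionalIdeal D⁰ K) : FractionalIdeal D⁰ K := (A⁻¹)⁻¹

lemma vClosure_zero : vClosure (0 : FractionalIdeal D⁰ K) = 0 := by
  rw [vClosure, FractionalIdeal.inv_zero', FractionalIdeal.inv_zero']

variable {K} in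
lemma le_inv_iff' {A B : FractionalIdeal D⁰ K} (hA : A ≠ 0) :
    B ≤ A⁻¹ ↔ ∀ x ∈ B, ∀ y ∈ A, x * y ∈ (1 : FractionalIdeal D⁰ K) := by
  constructor
  · intro h x hx
    exact (FractionalIdeal.mem_inv_iff hA).1 (h hx)
  · intro h x hx
    exact (FractionalIdeal.mem_inv_iff hA).2 (h x hx)

variable {K} in
lemma le_vClosure (A : FractionalIdeal D⁰ K) : A ≤ vClosure A := by
  by_cases hA : A = 0
  · subst hA; exact FractionalIdeal.zero_le _
  by_cases hA' : A⁻¹ = 0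
  · exfalso
    obtain ⟨a, ha, h⟩ := A.isFractional
    have hm : algebraMap D K a ∈ A⁻¹ := by
      refine (FractionalIdeal.mem_inv_iff hA).2 fun y hy => ?_
      obtain ⟨d, hd⟩ := h y hy
      refine (FractionalIdeal.mem_one_iff D⁰).2 ⟨d, ?_⟩
      rw [hd, Algebra.smul_def]
    rw [hA', FractionalIdeal.mem_zero_iff] at hm
    exact nonZeroDivisors.ne_zero ha
      ((map_eq_zero_iff _ (IsFractionRing.injective D K)).1 hm)
  · refine (le_inv_iff' hA').2 fun x hx y hy => ?_
    rw [mul_comm]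
    exact (FractionalIdeal.mem_inv_iff hA).1 hy x hx

variable {K} in
lemma inv_ne_zero' {A : FractionalIdeal D⁰ K} (hA : A ≠ 0) : A⁻¹ ≠ 0 := by
  intro h
  have := le_vClosure A
  rw [vClosure, h, FractionalIdeal.inv_zero'] at this
  exact hA (FractionalIdeal.le_zero_iff.1 this)

variable {K} in
lemma vClosure_mono {A B : FractionalIdeal D⁰ K} (h : A ≤ B) : vClosure A ≤ vClosure B := by
  by_cases hA : A = 0
  · subst hA; rw [vClosure_zero]; exact FractionalIdeal.zero_le _
  have hB : B ≠ 0 := fun hB => hA (FractionalIdeal.le_zero_iff.1 (hB ▸ h))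
  have h1 : B⁻¹ ≤ A⁻¹ := (le_inv_iff' hA).2 fun x hx y hy =>
    (FractionalIdeal.mem_inv_iff hB).1 hx y (h hy)
  exact (le_inv_iff' (inv_ne_zero' hB)).2 fun x hx y hy =>
    (FractionalIdeal.mem_inv_iff (inv_ne_zero' hA)).1 hx y (h1 hy)

variable {K} in
/-- The `t`-closure `A_t`: the union of all `J_v`, where `J` runs through the finitely generated
fractional ideals contained in `A` (allowing `J = 0` is harmless, since `0_v = 0`). -/
def tClosure (A : FractionalIdeal D⁰ K) : FractionalIdeal D⁰ K :=
  ⟨{ carrier := {x | ∃ J : FractionalIdeal D⁰ K,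
        J ≤ A ∧ (J : Submodule D K).FG ∧ x ∈ vClosure J}
     zero_mem' := ⟨0, FractionalIdeal.zero_le _, by
        rw [FractionalIdeal.coe_zero]; exact Submodule.fg_bot,
        by exact (vClosure (0 : FractionalIdeal D⁰ K) : Submodule D K).zero_mem⟩
     add_mem' := by
        rintro x y ⟨J, hJ, hJf, hx⟩ ⟨L, hL, hLf, hy⟩
        refine ⟨J ⊔ L, sup_le hJ hL, ?_,
          Submodule.add_mem (vClosure (J ⊔ L) : Submodule D K)
            (vClosure_mono le_sup_left hx) (vClosure_mono le_sup_right hy)⟩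
        rw [FractionalIdeal.coe_sup]
        exact hJf.sup hLf
     smul_mem' := by
        rintro c x ⟨J, hJ, hJf, hx⟩
        exact ⟨J, hJ, hJf, Submodule.smul_mem (vClosure J : Submodule D K) c hx⟩ }, by
    obtain ⟨a, ha, h⟩ := (vClosure A).isFractional
    refine ⟨a, ha, ?_⟩
    rintro x ⟨J, hJ, -, hx⟩
    exact h x (vClosure_mono hJ hx)⟩

lemma mem_tClosure {A : FractionalIdeal D⁰ K} {x : K} :
    x ∈ tClosure A ↔ ∃ J : FractionalIdeal D⁰ K,
      J ≤ A ∧ (J : Submodule D K).FG ∧ x ∈ vClosure J := by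
  rw [← FractionalIdeal.mem_coe]
  exact Iff.rfl

/-- A `t`-ideal: a nonzero integral ideal `I` of `D` with `I_t = I`. The ideal `D` is allowed. -/
def IsTIdeal (I : Ideal D) : Prop :=
  I ≠ ⊥ ∧ tClosure (I : FractionalIdeal D⁰ K) = (I : FractionalIdeal D⁰ K)

/-- A prime `t`-ideal (nonzero, as every `t`-ideal). -/
def IsPrimeTIdeal (P : Ideal D) : Prop := P.IsPrime ∧ IsTIdeal K P

/-- A maximal `t`-ideal: maximal among the proper `t`-ideals. -/
def IsMaximalTIdeal (M : Ideal D) : Prop := Maximal (fun I : Ideal D => IsTIdeal K I ∧ I ≠ ⊤) M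

/-- `I` is `t`-invertible: `I` is nonzero and `(I I⁻¹)_t = D`. -/
def IsTInvertible (I : Ideal D) : Prop :=
  I ≠ ⊥ ∧ tClosure ((I : FractionalIdeal D⁰ K) * (I : FractionalIdeal D⁰ K)⁻¹) = 1

/-- `I` is a valuation ideal: `IV ∩ D = I` for some valuation ring `V` with `D ⊆ V ⊆ K`. -/
def IsValuationIdeal (I : Ideal D) : Prop :=
  ∃ V : ValuationSubring K, (∀ d : D, algebraMap D K d ∈ V) ∧
    ∀ d : D, algebraMap D K d ∈ Submodule.span V (algebraMap D K '' (I : Set D)) ↔ d ∈ I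

variable (D)

/-- `D` is a `t`-VIFD: every nonzero principal ideal is a finite `t`-product of valuation ideals
(these are automatically nonzero). -/
def IsTVIFD : Prop :=
  ∀ a : D, a ≠ 0 → ∃ (n : ℕ) (I : Fin n → Ideal D), 1 ≤ n ∧ (∀ i, IsValuationIdeal K (I i)) ∧
    (Ideal.span {a} : FractionalIdeal D⁰ K) = tClosure (∏ i, (I i : FractionalIdeal D⁰ K))

/-- `t`-dimension: the supremum of all `n` for which there is a chain `P₁ ⊊ ⋯ ⊊ Pₙ` of
(nonzero) prime `t`-ideals. -/
def tDim : ℕ∞ :=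
  ⨆ (n : ℕ) (_ : ∃ P : Fin n → Ideal D, StrictMono P ∧ ∀ i, IsPrimeTIdeal K (P i)), (n : ℕ∞)

/-- Finite `t`-character: every nonzero nonunit lies in only finitely many maximal `t`-ideals. -/
def HasFiniteTCharacter : Prop :=
  ∀ a : D, a ≠ 0 → ¬ IsUnit a → {M : Ideal D | IsMaximalTIdeal K M ∧ a ∈ M}.Finite

/-- Prüfer `v`-multiplication domain: every nonzero finitely generated ideal is `t`-invertible. -/
def IsPvMD : Prop := ∀ I : Ideal D, I ≠ ⊥ → I.FG → IsTInvertible K I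

/-- A generalized Krull domain: a P`v`MD of `t`-dimension at most one and of finite
`t`-character. -/
def IsGeneralizedKrullDomain : Prop :=
  IsPvMD D K ∧ tDim D K ≤ 1 ∧ HasFiniteTCharacter D K

/-- `D` is completely integrally closed: every almost integral element of `K` lies in `D`. -/
def IsCompletelyIntegrallyClosed : Prop :=
  ∀ x : K, IsAlmostIntegral D x → x ∈ (algebraMap D K).range

end

/-- The Principal Ideal Theorem: every prime minimal over a nonzero principal ideal has height
one. -/
def SatisfiesPIT (D : Type*) [CommRing D] : Prop :=
  ∀ a : D, a ≠ 0 → ∀ P ∈ (Ideal.span {a}).minimalPrimes, P.height = 1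

end TVIFD

namespace TVIFD

open scoped nonZeroDivisors
open FractionalIdeal

set_option linter.unusedSectionVars false

variable {D : Type*} [CommRing D] [IsDomain D]
variable {K : Type*} [Field K] [Algebra D K] [IsFractionRing D K]

/-! ### Calculus of the `t`-operation -/

section TOperation

/-! Statement 3 is the hub: 3 → 1 → 2 → 3 and 3 → 4 → 5 → 3.

A factor of a principal `t`-product is `t`-invertible, so every nonzero principal ideal is a
`t`-product of `t`-invertible valuation ideals. The carrier is `TVal V A`: integral, `t`-invertible
`A` with `AV ∩ D ⊆ A_t`. For fixed `V` this property survives products (`TVal.mul`) and passes up to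
larger `t`-invertible integral ideals (`TVal.of_le`), and any two such ideals are comparable up to
`t`-closure (`TVal.le_total`).

Radicals of proper valuation ideals are prime, so all `t`-invertible valuation ideals inside a
height one prime `P` have radical `P`. Some power of one lies in the `t`-closure of any other, so a
single `V` serves all their products. These are then linearly ordered up to `t`-closure, and `D_P`
is a valuation ring. Under 3, valuation ideals inside `P` have `P`-primary `t`-closure, whence `D =
⋂ D_P` over height one primes, with finite character. This yields 1 and 4.

For 4 → 5, a nonzero `c` in all `(I^n)_t` makes `I⁻¹` almost integral, forcing `I⁻¹ ⊆ D`. For 5 → 3,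
nonzero primes `Q ⊊ P` with `P` minimal over a principal ideal produce a valuation ideal inside `Q`
contained in every `(I^m)_t`. For 2 → 3, primes minimal over nonzero principal ideals are
`t`-ideals. -/

lemma tClosure_mono {A B : FractionalIdeal D⁰ K} (h : A ≤ B) : tClosure A ≤ tClosure B := by
  intro x hx
  obtain ⟨J, hJ, hJf, hxJ⟩ := (mem_tClosure K).1 hx
  exact (mem_tClosure K).2 ⟨J, hJ.trans h, hJf, hxJ⟩

lemma le_tClosure (A : FractionalIdeal D⁰ K) : A ≤ tClosure A := by
  intro x hx
  refine (mem_tClosure K).2 ⟨spanSingleton D⁰ x, spanSingleton_le_iff_mem.2 hx, ?_,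
    le_vClosure _ (mem_spanSingleton_self _ x)⟩
  rw [coe_spanSingleton]
  exact Submodule.fg_span_singleton x

lemma vClosure_vClosure_le (A : FractionalIdeal D⁰ K) : vClosure (vClosure A) ≤ vClosure A := by
  by_cases hA : A = 0
  · simp [hA, vClosure_zero]
  have h1 : A⁻¹ ≠ 0 := inv_ne_zero' hA
  have h2 : vClosure A⁻¹ ≠ 0 := inv_ne_zero' (inv_ne_zero' h1)
  exact inv_anti_mono h1 h2 (le_vClosure A⁻¹)

/-- Finitely many generators use finitely many `J`, whose sum serves for all of them. This
finiteness is what makes the `t`-closure idempotent. -/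
lemma exists_fg_le_vClosure {A : FractionalIdeal D⁰ K} {N : Submodule D K} (hN : N.FG)
    (h : ∀ x ∈ N, x ∈ tClosure A) :
    ∃ L : FractionalIdeal D⁰ K, L ≤ A ∧ (L : Submodule D K).FG ∧ ∀ x ∈ N, x ∈ vClosure L := by
  classical
  obtain ⟨s, rfl⟩ := hN
  have key : ∀ s : Finset K, (∀ x ∈ s, x ∈ tClosure A) →
      ∃ L : FractionalIdeal D⁰ K, L ≤ A ∧ (L : Submodule D K).FG ∧ ∀ x ∈ s, x ∈ vClosure L := by
    intro s
    induction s using Finset.induction_on with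
    | empty =>
      exact fun _ => ⟨0, FractionalIdeal.zero_le _, by
        rw [FractionalIdeal.coe_zero]; exact Submodule.fg_bot, by simp⟩
    | insert a s ha ih =>
      intro hs
      obtain ⟨L, hL, hLf, hLs⟩ := ih fun x hx => hs x (Finset.mem_insert_of_mem hx)
      obtain ⟨J, hJ, hJf, haJ⟩ := (mem_tClosure K).1 (hs a (Finset.mem_insert_self a s))
      refine ⟨J ⊔ L, sup_le hJ hL, by rw [FractionalIdeal.coe_sup]; exact hJf.sup hLf, ?_⟩
      intro x hx
      rcases Finset.mem_insert.1 hx with rfl | hx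
      · exact vClosure_mono le_sup_left haJ
      · exact vClosure_mono le_sup_right (hLs x hx)
  obtain ⟨L, hL, hLf, hLs⟩ := key s fun x hx => h x (Submodule.subset_span hx)
  exact ⟨L, hL, hLf, fun x hx =>
    (Submodule.span_le.2 hLs : _ ≤ (vClosure L : Submodule D K)) hx⟩

lemma tClosure_le_of_le {A B : FractionalIdeal D⁰ K} (h : A ≤ tClosure B) :
    tClosure A ≤ tClosure B := by
  intro x hx
  obtain ⟨J, hJ, hJf, hxJ⟩ := (mem_tClosure K).1 hx
  obtain ⟨L, hL, hLf, hLs⟩ := exists_fg_le_vClosure hJf fun y hy => h (hJ hy)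
  refine (mem_tClosure K).2 ⟨L, hL, hLf, vClosure_vClosure_le L ?_⟩
  exact vClosure_mono (fun y hy => hLs y hy) hxJ

lemma tClosure_tClosure (A : FractionalIdeal D⁰ K) : tClosure (tClosure A) = tClosure A :=
  le_antisymm (tClosure_le_of_le le_rfl) (le_tClosure _)

lemma tClosure_zero : tClosure (0 : FractionalIdeal D⁰ K) = 0 := by
  refine le_antisymm (fun x hx => ?_) (FractionalIdeal.zero_le _)
  obtain ⟨J, hJ, -, hxJ⟩ := (mem_tClosure K).1 hx
  rwa [FractionalIdeal.le_zero_iff.1 hJ, vClosure_zero] at hxJ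

lemma mul_mem_vClosure (a : K) {x : K} {J : FractionalIdeal D⁰ K} (hx : x ∈ vClosure J) :
    a * x ∈ vClosure (spanSingleton D⁰ a * J) := by
  by_cases ha : a = 0
  · rw [ha, zero_mul]
    exact (vClosure (spanSingleton D⁰ 0 * J) : Submodule D K).zero_mem
  by_cases hJ : J = 0
  · rw [hJ, vClosure_zero, mem_zero_iff] at hx
    rw [hx, mul_zero]
    exact (vClosure (spanSingleton D⁰ a * J) : Submodule D K).zero_mem
  have hJ' : spanSingleton D⁰ a * J ≠ 0 := by
    obtain ⟨j, hj, hj0⟩ : ∃ j ∈ J, j ≠ 0 := by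
      by_contra! h
      exact hJ (eq_zero_iff.2 h)
    intro h
    have : a * j ∈ spanSingleton D⁰ a * J := mul_mem_mul (mem_spanSingleton_self _ a) hj
    rw [h, mem_zero_iff] at this
    exact mul_ne_zero ha hj0 this
  refine (mem_inv_iff (inv_ne_zero' hJ')).2 fun y hy => ?_
  have h1 : a * y ∈ J⁻¹ := (mem_inv_iff hJ).2 fun j hj => by
    have := (mem_inv_iff hJ').1 hy (a * j) (mul_mem_mul (mem_spanSingleton_self _ a) hj)
    convert this using 1
    ring
  convert (mem_inv_iff (inv_ne_zero' hJ)).1 hx _ h1 using 1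
  ring

lemma mul_tClosure_le (A B : FractionalIdeal D⁰ K) : A * tClosure B ≤ tClosure (A * B) := by
  refine FractionalIdeal.mul_le.2 fun a ha x hx => ?_
  obtain ⟨J, hJ, hJf, hxJ⟩ := (mem_tClosure K).1 hx
  refine (mem_tClosure K).2 ⟨spanSingleton D⁰ a * J,
    mul_le_mul' (spanSingleton_le_iff_mem.2 ha) hJ, ?_, mul_mem_vClosure a hxJ⟩
  rw [FractionalIdeal.coe_mul, coe_spanSingleton]
  exact (Submodule.fg_span_singleton a).mul hJf

lemma tClosure_mul_le (A B : FractionalIdeal D⁰ K) : tClosure A * B ≤ tClosure (A * B) := by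
  rw [mul_comm, mul_comm A]
  exact mul_tClosure_le B A

lemma tClosure_pow_le (A : FractionalIdeal D⁰ K) (n : ℕ) :
    tClosure A ^ n ≤ tClosure (A ^ n) := by
  induction n with
  | zero => simpa using le_tClosure (1 : FractionalIdeal D⁰ K)
  | succ n ih =>
    rw [pow_succ, pow_succ]
    calc tClosure A ^ n * tClosure A ≤ tClosure (A ^ n) * tClosure A := mul_le_mul_left ih _
      _ ≤ tClosure (tClosure (A ^ n) * A) := mul_tClosure_le _ _
      _ ≤ tClosure (A ^ n * A) := tClosure_le_of_le (tClosure_mul_le _ _)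

lemma tClosure_one : tClosure (1 : FractionalIdeal D⁰ K) = 1 := by
  refine le_antisymm (fun x hx => ?_) (le_tClosure _)
  obtain ⟨J, hJ, -, hxJ⟩ := (mem_tClosure K).1 hx
  have := vClosure_mono hJ hxJ
  rwa [vClosure, inv_eq, inv_eq, FractionalIdeal.div_one, FractionalIdeal.div_one] at this

lemma tClosure_spanSingleton (a : K) :
    tClosure (spanSingleton D⁰ a) = spanSingleton D⁰ a := by
  refine le_antisymm (fun x hx => ?_) (le_tClosure _)
  obtain ⟨J, hJ, -, hxJ⟩ := (mem_tClosure K).1 hx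
  have := vClosure_mono hJ hxJ
  rwa [vClosure, FractionalIdeal.spanSingleton_inv, FractionalIdeal.spanSingleton_inv,
    inv_inv] at this

lemma tClosure_le_one {A : FractionalIdeal D⁰ K} (h : A ≤ 1) : tClosure A ≤ 1 :=
  (tClosure_mono h).trans_eq tClosure_one

lemma mul_inv_le_one (A : FractionalIdeal D⁰ K) : A * A⁻¹ ≤ 1 := by
  rw [inv_eq]; exact FractionalIdeal.mul_one_div_le_one

lemma tClosure_mul_inv_le_one (A : FractionalIdeal D⁰ K) : tClosure A * A⁻¹ ≤ 1 :=
  (tClosure_mul_le _ _).trans (tClosure_le_one (mul_inv_le_one A))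

lemma le_inv_of_mul_le_one {A B : FractionalIdeal D⁰ K} (hA : A ≠ 0) (h : A * B ≤ 1) :
    B ≤ A⁻¹ :=
  (le_inv_iff' hA).2 fun x hx y hy => mul_comm y x ▸ h (mul_mem_mul hy hx)

/-- Cancellation of a factor whose `t`-closure contains 1, typically `A * A⁻¹` with `A`
`t`-invertible. -/
lemma le_tClosure_of_mul_le {B C E : FractionalIdeal D⁰ K} (hC : 1 ≤ tClosure C)
    (h : B * C ≤ tClosure E) : B ≤ tClosure E :=
  calc B = B * 1 := (mul_one B).symm
    _ ≤ B * tClosure C := mul_le_mul_right hC _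
    _ ≤ tClosure (B * C) := mul_tClosure_le _ _
    _ ≤ tClosure E := tClosure_le_of_le h

end TOperation

/-! ### `t`-invertible ideals that are valuation ideals up to `t`-closure -/

section TValuation

/-- A fractional ideal with `(A A⁻¹)_t = D`. -/
def TInv (A : FractionalIdeal D⁰ K) : Prop := 1 ≤ tClosure (A * A⁻¹)

lemma TInv.ne_zero {A : FractionalIdeal D⁰ K} (h : TInv A) : A ≠ 0 := by
  rintro rfl
  rw [TInv, zero_mul, tClosure_zero] at h
  exact one_ne_zero (FractionalIdeal.le_zero_iff.1 h)

lemma isTInvertible_iff {I : Ideal D} : IsTInvertible K I ↔ TInv (I : FractionalIdeal D⁰ K) :=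
  ⟨fun h => h.2.ge, fun h => ⟨coeIdeal_ne_zero.1 h.ne_zero,
    le_antisymm (tClosure_le_one (mul_inv_le_one _)) h⟩⟩

lemma TInv.of_mul_le {A B : FractionalIdeal D⁰ K} (hAB : A * B ≤ 1)
    (h : 1 ≤ tClosure (A * B)) : TInv A := by
  have hA : A ≠ 0 := by
    rintro rfl
    rw [zero_mul, tClosure_zero] at h
    exact one_ne_zero (FractionalIdeal.le_zero_iff.1 h)
  exact h.trans (tClosure_mono (mul_le_mul_right (le_inv_of_mul_le_one hA hAB) _))

lemma tInv_one : TInv (1 : FractionalIdeal D⁰ K) :=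
  TInv.of_mul_le (B := 1) (by simp)
    (by simpa using le_tClosure (1 : FractionalIdeal D⁰ K))

lemma TInv.mul {A B : FractionalIdeal D⁰ K} (hA : TInv A) (hB : TInv B) : TInv (A * B) := by
  have e : A * B * (A⁻¹ * B⁻¹) = A * A⁻¹ * (B * B⁻¹) := by ring
  refine TInv.of_mul_le (B := A⁻¹ * B⁻¹) ?_ ?_
  · rw [e]
    exact mul_le_one' (mul_inv_le_one A) (mul_inv_le_one B)
  · refine le_tClosure_of_mul_le hA (le_tClosure_of_mul_le hB ?_)
    rw [e, one_mul]
    exact le_tClosure _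

lemma TInv.pow {A : FractionalIdeal D⁰ K} (hA : TInv A) (n : ℕ) : TInv (A ^ n) := by
  induction n with
  | zero => simpa using tInv_one
  | succ n ih => rw [pow_succ]; exact ih.mul hA

lemma TInv.inv {A : FractionalIdeal D⁰ K} (hA : TInv A) : TInv A⁻¹ := by
  refine TInv.of_mul_le (B := A) ?_ ?_
  all_goals rw [mul_comm]
  exacts [mul_inv_le_one A, hA]

/-- `A` is a `t`-invertible integral ideal, and `AV ∩ D ⊆ A_t`. -/
structure TVal (V : ValuationSubring K) (A : FractionalIdeal D⁰ K) : Prop where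
  le_one : A ≤ 1
  tInv : TInv A
  mem : ∀ r ∈ (1 : FractionalIdeal D⁰ K), ∀ a ∈ A, V.valuation r ≤ V.valuation a → r ∈ tClosure A

variable {V : ValuationSubring K}

lemma valuation_le_one_of_mem_one (hV : ∀ d : D, algebraMap D K d ∈ V) {r : K}
    (hr : r ∈ (1 : FractionalIdeal D⁰ K)) : V.valuation r ≤ 1 := by
  obtain ⟨d, rfl⟩ := (mem_one_iff D⁰).1 hr
  exact (V.valuation_le_one_iff _).2 (hV d)

lemma tVal_one : TVal V (1 : FractionalIdeal D⁰ K) :=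
  ⟨le_rfl, tInv_one, fun _ hr _ _ _ => le_tClosure _ hr⟩

/-- Membership in a product is tested by dividing by its `t`-invertible factor. -/
lemma TInv.spanSingleton_mul_inv_le {A B : FractionalIdeal D⁰ K} (hA : TInv A) {r : K}
    (h : spanSingleton D⁰ r * A⁻¹ ≤ tClosure B) : r ∈ tClosure (B * A) := by
  rw [← spanSingleton_le_iff_mem]
  refine le_tClosure_of_mul_le hA ?_
  calc spanSingleton D⁰ r * (A * A⁻¹) = spanSingleton D⁰ r * A⁻¹ * A := by ring
    _ ≤ tClosure B * A := mul_le_mul_left h _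
    _ ≤ tClosure (B * A) := tClosure_mul_le _ _

lemma exists_le_valuation_of_mem_mul {A B : FractionalIdeal D⁰ K} {x : K} (hx : x ∈ A * B) :
    ∃ a ∈ A, ∃ b ∈ B, V.valuation x ≤ V.valuation (a * b) := by
  refine FractionalIdeal.mul_induction_on hx (fun i hi j hj => ⟨i, hi, j, hj, le_rfl⟩) ?_
  · rintro x y ⟨a, ha, b, hb, hab⟩ ⟨c, hc, d, hd, hcd⟩
    rcases le_total (V.valuation (a * b)) (V.valuation (c * d)) with h | h
    · exact ⟨c, hc, d, hd, (V.valuation.map_add _ _).trans (max_le (hab.trans h) hcd)⟩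
    · exact ⟨a, ha, b, hb, (V.valuation.map_add _ _).trans (max_le hab (hcd.trans h))⟩

/-- If `v(r) ≤ v(ab)`, then `v(r) ≤ v(a)` already puts `r` in `A_t`. So for `y ∈ A⁻¹` the element
`ry` is in `D` with value at most `v(ay)v(b) ≤ v(b)`, hence in `B_t`. Multiplying `rA⁻¹ ⊆ B_t` by
`A` recovers `r`. -/
lemma TVal.mul (hV : ∀ d : D, algebraMap D K d ∈ V) {A B : FractionalIdeal D⁰ K}
    (hA : TVal V A) (hB : TVal V B) : TVal V (A * B) := by
  refine ⟨mul_le_one' hA.le_one hB.le_one, hA.tInv.mul hB.tInv, fun r hr x hx hrx => ?_⟩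
  obtain ⟨a, ha, b, hb, hab⟩ := exists_le_valuation_of_mem_mul (V := V) hx
  have hrA : r ∈ tClosure A := by
    refine hA.mem r hr a ha (hrx.trans (hab.trans ?_))
    rw [map_mul]
    exact mul_le_of_le_one_right' (valuation_le_one_of_mem_one hV (hB.le_one hb))
  rw [mul_comm]
  refine hA.tInv.spanSingleton_mul_inv_le (spanSingleton_mul_le_iff.2 fun y hy => ?_)
  refine hB.mem _ (tClosure_mul_inv_le_one A (mul_mem_mul hrA hy)) b hb ?_
  have h1 : V.valuation (a * y) ≤ 1 :=
    valuation_le_one_of_mem_one hV (mul_inv_le_one A (mul_mem_mul ha hy))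
  calc V.valuation (r * y) ≤ V.valuation (a * b) * V.valuation y := by
        rw [map_mul]; exact mul_le_mul_left (hrx.trans hab) _
    _ = V.valuation (a * y) * V.valuation b := by
        simp only [map_mul]; exact mul_right_comm _ _ _
    _ ≤ V.valuation b := mul_le_of_le_one_left' h1

lemma TVal.pow (hV : ∀ d : D, algebraMap D K d ∈ V) {A : FractionalIdeal D⁰ K}
    (hA : TVal V A) (n : ℕ) : TVal V (A ^ n) := by
  induction n with
  | zero => simpa using tVal_one
  | succ n ih => rw [pow_succ]; exact ih.mul hV hA

/-- For `v(r) ≤ v(a)`, the property of `B` gives `rA⁻¹B ⊆ B_t`. Cancelling `B` leaves `rA⁻¹ ⊆ D`,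
that is, `r ∈ A_t`. -/
lemma TVal.of_le (hV : ∀ d : D, algebraMap D K d ∈ V) {A B : FractionalIdeal D⁰ K}
    (hB : TVal V B) (hA : TInv A) (hA1 : A ≤ 1) (h : B ≤ tClosure A) : TVal V A := by
  refine ⟨hA1, hA, fun r hr a ha hra => ?_⟩
  have h1 : spanSingleton D⁰ r * A⁻¹ * B ≤ tClosure B := by
    rw [mul_assoc]
    refine spanSingleton_mul_le_iff.2 fun z hz => ?_
    have hz1 : r * z ∈ (1 : FractionalIdeal D⁰ K) := by
      refine mul_le_one' (spanSingleton_le_iff_mem.2 hr)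
        ((mul_le_mul_right h _).trans ((mul_comm _ _).trans_le (tClosure_mul_inv_le_one A)))
        (mul_mem_mul (mem_spanSingleton_self _ r) hz)
    obtain ⟨y, hy, b, hb, hyb⟩ := exists_le_valuation_of_mem_mul (V := V) hz
    refine hB.mem _ hz1 b hb ?_
    have h1 : V.valuation (a * y) ≤ 1 :=
      valuation_le_one_of_mem_one hV (mul_inv_le_one A (mul_mem_mul ha hy))
    calc V.valuation (r * z) ≤ V.valuation a * V.valuation (y * b) := by
          rw [map_mul]; exact mul_le_mul' hra hyb
      _ = V.valuation (a * y) * V.valuation b := by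
          simp only [map_mul]; exact (mul_assoc _ _ _).symm
      _ ≤ V.valuation b := mul_le_of_le_one_left' h1
  have h2 : spanSingleton D⁰ r * A⁻¹ ≤ tClosure 1 := by
    refine le_tClosure_of_mul_le hB.tInv ?_
    rw [tClosure_one, ← mul_assoc]
    exact (mul_le_mul_left h1 _).trans (tClosure_mul_inv_le_one B)
  simpa using hA.spanSingleton_mul_inv_le h2

/-- Either the values on `B` dominate those on `A`, or one element of `A` has larger value than all
of `B`. -/
lemma TVal.le_total {A B : FractionalIdeal D⁰ K} (hA : TVal V A) (hB : TVal V B) :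
    A ≤ tClosure B ∨ B ≤ tClosure A := by
  by_cases h : ∀ a ∈ A, ∃ b ∈ B, V.valuation a ≤ V.valuation b
  · left
    intro a ha
    obtain ⟨b, hb, hab⟩ := h a ha
    exact hB.mem a (hA.le_one ha) b hb hab
  · right
    push Not at h
    obtain ⟨a, ha, hab⟩ := h
    exact fun b hb => hA.mem b (hB.le_one hb) a ha (hab b hb).le

end TValuation

/-! ### Prime `t`-ideals and `t`-invertible ideals -/

section PrimeTIdeals

lemma algebraMap_mem_coeIdeal {I : Ideal D} {d : D} :
    algebraMap D K d ∈ (I : FractionalIdeal D⁰ K) ↔ d ∈ I := by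
  rw [mem_coeIdeal]
  exact ⟨fun ⟨e, he, h⟩ => IsFractionRing.injective D K h ▸ he, fun h => ⟨d, h, rfl⟩⟩

lemma exists_eq_algebraMap {A : FractionalIdeal D⁰ K} (hA : A ≤ 1) {x : K} (hx : x ∈ A) :
    ∃ d : D, algebraMap D K d = x := (mem_one_iff D⁰).1 (hA hx)

variable (K) in
lemma exists_coeIdeal_eq_tClosure (I : Ideal D) :
    ∃ T : Ideal D, (T : FractionalIdeal D⁰ K) = tClosure (I : FractionalIdeal D⁰ K) :=
  le_one_iff_exists_coeIdeal.1 (tClosure_le_one coeIdeal_le_one)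

lemma isTIdeal_of_coe_eq_tClosure {T I : Ideal D} (hI : I ≠ ⊥)
    (h : (T : FractionalIdeal D⁰ K) = tClosure (I : FractionalIdeal D⁰ K)) :
    IsTIdeal K T := by
  refine ⟨?_, by rw [h, tClosure_tClosure]⟩
  rintro rfl
  rw [coeIdeal_bot] at h
  exact hI (coeIdeal_eq_zero.1 (FractionalIdeal.le_zero_iff.1 (h ▸ le_tClosure _)))

lemma IsTIdeal.tClosure_le {P : Ideal D} (hP : IsTIdeal K P) {A : FractionalIdeal D⁰ K}
    (h : A ≤ P) : tClosure A ≤ P := (tClosure_mono h).trans_eq hP.2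

lemma not_one_le_coeIdeal {P : Ideal D} (hP : P ≠ ⊤) :
    ¬ 1 ≤ (P : FractionalIdeal D⁰ K) := by
  rw [← coeIdeal_top, coeIdeal_le_coeIdeal K]
  exact fun h => hP (top_le_iff.1 h)

variable (K) in
lemma isTIdeal_span_singleton {a : D} (ha : a ≠ 0) : IsTIdeal K (Ideal.span {a}) :=
  ⟨by simpa using ha, by rw [coeIdeal_span_singleton, tClosure_spanSingleton]⟩

/-- Otherwise `I` is disjoint from the monoid generated by `p` and the complement of `P`, and a
prime over `I` avoiding this monoid lies strictly inside `P`. -/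
lemma exists_notMem_mul_pow_mem {I P : Ideal D} (hP : P ∈ I.minimalPrimes) {p : D} (hp : p ∈ P) :
    ∃ s ∉ P, ∃ n : ℕ, s * p ^ n ∈ I := by
  by_contra! h
  have := hP.1.1
  have hd : Disjoint (I : Set D) (P.primeCompl ⊔ Submonoid.powers p : Submonoid D) := by
    rw [Set.disjoint_left]
    rintro x hx hx'
    obtain ⟨s, hs, z, ⟨n, rfl⟩, rfl⟩ := Submonoid.mem_sup.1 hx'
    exact h s hs n hx
  obtain ⟨Q, hQ, hIQ, hQd⟩ := Ideal.exists_le_prime_disjoint I _ hd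
  rw [Set.disjoint_left] at hQd
  have hQP : Q ≤ P := fun x hx => by
    by_contra hxP
    exact hQd hx (Submonoid.mem_sup_left (S := P.primeCompl) hxP)
  exact hQd (hP.2 ⟨hQ, hIQ⟩ hQP hp) (Submonoid.mem_sup_right (Submonoid.mem_powers p))

lemma exists_notMem_forall_mul_mem {I P : Ideal D} (hP : P ∈ I.minimalPrimes) {J : Ideal D}
    (hJ : J.FG) (hJP : J ≤ P) : ∃ s ∉ P, ∃ n : ℕ, ∀ x ∈ J ^ n, s * x ∈ I := by
  have := hP.1.1
  induction J, hJ using Submodule.fg_induction with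
  | singleton p =>
    obtain ⟨s, hs, n, hsn⟩ := exists_notMem_mul_pow_mem hP (hJP (Submodule.mem_span_singleton_self p))
    refine ⟨s, hs, n, fun x hx => ?_⟩
    rw [← Ideal.span, Ideal.span_singleton_pow, Ideal.mem_span_singleton'] at hx
    obtain ⟨c, rfl⟩ := hx
    rw [mul_left_comm]
    exact I.mul_mem_left c hsn
  | sup J₁ J₂ _ _ h₁ h₂ =>
    obtain ⟨s, hs, m, hsm⟩ := h₁ (le_sup_left.trans hJP)
    obtain ⟨t, ht, n, htn⟩ := h₂ (le_sup_right.trans hJP)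
    refine ⟨s * t, fun h => (this.mem_or_mem h).elim hs ht, m + n, fun x hx => ?_⟩
    obtain ⟨y, hy, z, hz, rfl⟩ := Submodule.mem_sup.1 (Ideal.sup_pow_add_le_pow_sup_pow hx)
    rw [show s * t * (y + z) = t * (s * y) + s * (t * z) by ring]
    exact I.add_mem (I.mul_mem_left _ (hsm y hy)) (I.mul_mem_left _ (htn z hz))

/-- A prime ideal minimal over a `t`-ideal is a `t`-ideal. -/
lemma IsTIdeal.of_mem_minimalPrimes {I P : Ideal D} (hI : IsTIdeal K I)
    (hP : P ∈ I.minimalPrimes) : IsTIdeal K P := by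
  refine ⟨fun h => hI.1 (le_bot_iff.1 (h ▸ hP.1.2)), le_antisymm (fun x hx => ?_) (le_tClosure _)⟩
  obtain ⟨d, rfl⟩ := exists_eq_algebraMap (tClosure_le_one coeIdeal_le_one) hx
  obtain ⟨J, hJ, hJf, hxJ⟩ := (mem_tClosure K).1 hx
  obtain ⟨J, rfl⟩ := le_one_iff_exists_coeIdeal.1 (hJ.trans coeIdeal_le_one)
  rw [coeIdeal_le_coeIdeal K] at hJ
  obtain ⟨s, hs, n, hsn⟩ := exists_notMem_forall_mul_mem hP
    ((coeIdeal_fg D⁰ (IsFractionRing.injective D K) J).1 hJf) hJ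
  have hxt : algebraMap D K d ∈ tClosure (J : FractionalIdeal D⁰ K) :=
    (mem_tClosure K).2 ⟨_, le_rfl, hJf, hxJ⟩
  -- With `d ∈ J_t` and `sJ^n ⊆ I`, the element `s * d ^ n` lies in `(sJ^n)_t ⊆ I_t = I`.
  have h1 : algebraMap D K (s * d ^ n) ∈ (I : FractionalIdeal D⁰ K) := by
    have h2 : spanSingleton D⁰ (algebraMap D K s) * (J : FractionalIdeal D⁰ K) ^ n ≤ I := by
      refine spanSingleton_mul_le_iff.2 fun z hz => ?_
      rw [← coeIdeal_pow] at hz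
      obtain ⟨e, he, rfl⟩ := (mem_coeIdeal D⁰).1 hz
      rw [← map_mul]
      exact algebraMap_mem_coeIdeal.2 (hsn e he)
    have h3 : (algebraMap D K d) ^ n ∈ tClosure ((J : FractionalIdeal D⁰ K) ^ n) := by
      rw [← spanSingleton_le_iff_mem, ← spanSingleton_pow]
      exact (pow_le_pow_left' (spanSingleton_le_iff_mem.2 hxt) n).trans (tClosure_pow_le _ n)
    rw [map_mul, map_pow]
    exact hI.tClosure_le h2
      (mul_tClosure_le _ _ (mul_mem_mul (mem_spanSingleton_self _ _) h3))
  have := hP.1.1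
  have h2 := hP.1.2 (algebraMap_mem_coeIdeal.1 h1)
  exact algebraMap_mem_coeIdeal.2 (this.mem_of_pow_mem n ((this.mem_or_mem h2).resolve_left hs))

/-- A `t`-invertible ideal is locally principal at every proper `t`-ideal. -/
lemma TInv.exists_mul_eq {I P : Ideal D} (hI : TInv (I : FractionalIdeal D⁰ K))
    (hP : IsTIdeal K P) (hP1 : P ≠ ⊤) : ∃ q ∈ I, ∃ s ∉ P, ∀ x : D,
      algebraMap D K x ∈ tClosure (I : FractionalIdeal D⁰ K) → ∃ c, s * x = q * c := by
  -- Some product `q * y` with `q ∈ I`, `y ∈ I⁻¹` lies outside `P`; it serves as `s`, and `c` is `x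
  -- * y`.
  have h : ¬ (I : FractionalIdeal D⁰ K) * (I : FractionalIdeal D⁰ K)⁻¹ ≤ P :=
    fun h => not_one_le_coeIdeal hP1 (hI.trans (hP.tClosure_le h))
  rw [FractionalIdeal.mul_le] at h
  push Not at h
  obtain ⟨i, hi, y, hy, hiy⟩ := h
  obtain ⟨s, hs⟩ := exists_eq_algebraMap (mul_inv_le_one _) (mul_mem_mul hi hy)
  obtain ⟨q, hq, rfl⟩ := (mem_coeIdeal D⁰).1 hi
  rw [← hs, algebraMap_mem_coeIdeal] at hiy
  refine ⟨q, hq, s, hiy, fun x hx => ?_⟩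
  obtain ⟨c, hc⟩ := exists_eq_algebraMap (tClosure_mul_inv_le_one _) (mul_mem_mul hx hy)
  refine ⟨c, IsFractionRing.injective D K ?_⟩
  rw [map_mul, map_mul, hs, hc]
  ring

/-- `I` is principal locally at `P`, so `Q` itself need not be a `t`-ideal. -/
lemma TInv.tClosure_le_of_le_prime {I P Q : Ideal D} (hI : TInv (I : FractionalIdeal D⁰ K))
    (hP : IsTIdeal K P) (hP1 : P ≠ ⊤) (hQ : Q.IsPrime) (hQP : Q ≤ P) (hIQ : I ≤ Q) {x : D}
    (hx : algebraMap D K x ∈ tClosure (I : FractionalIdeal D⁰ K)) : x ∈ Q := by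
  obtain ⟨q, hq, s, hs, h⟩ := hI.exists_mul_eq hP hP1
  obtain ⟨c, hc⟩ := h x hx
  refine (hQ.mem_or_mem (hc ▸ Q.mul_mem_right c (hIQ hq) : s * x ∈ Q)).resolve_left
    fun h => hs (hQP h)

lemma exists_fg_le_of_le_mul {I : Ideal D} {B : FractionalIdeal D⁰ K} {N : Submodule D K}
    (hN : N.FG) (h : N ≤ ((I : FractionalIdeal D⁰ K) * B : FractionalIdeal D⁰ K)) :
    ∃ J : Ideal D, J.FG ∧ J ≤ I ∧ N ≤ ((J : FractionalIdeal D⁰ K) * B : FractionalIdeal D⁰ K) := by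
  induction N, hN using Submodule.fg_induction with
  | singleton x =>
    have hx : x ∈ (I : FractionalIdeal D⁰ K) * B := h (Submodule.mem_span_singleton_self x)
    suffices H : ∃ J : Ideal D, J.FG ∧ J ≤ I ∧ x ∈ (J : FractionalIdeal D⁰ K) * B by
      obtain ⟨J, hJ, hJI, hxJ⟩ := H
      exact ⟨J, hJ, hJI, (Submodule.span_singleton_le_iff_mem _ _).2 hxJ⟩
    refine FractionalIdeal.mul_induction_on hx (fun i hi b hb => ?_) ?_
    · obtain ⟨d, hd, rfl⟩ := (mem_coeIdeal D⁰).1 hi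
      exact ⟨Ideal.span {d}, Submodule.fg_span_singleton d,
        (Ideal.span_singleton_le_iff_mem I).2 hd,
        mul_mem_mul (algebraMap_mem_coeIdeal.2 (Ideal.mem_span_singleton_self d)) hb⟩
    · rintro y z ⟨J, hJ, hJI, hy⟩ ⟨L, hL, hLI, hz⟩
      refine ⟨J ⊔ L, Submodule.FG.sup hJ hL, sup_le hJI hLI,
        Submodule.add_mem (((J ⊔ L : Ideal D) : FractionalIdeal D⁰ K) * B : FractionalIdeal D⁰ K).1
          (mul_le_mul_left ((coeIdeal_le_coeIdeal K).2 le_sup_left) B hy)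
          (mul_le_mul_left ((coeIdeal_le_coeIdeal K).2 le_sup_right) B hz)⟩
  | sup N₁ N₂ _ _ h₁ h₂ =>
    obtain ⟨J, hJ, hJI, hy⟩ := h₁ (le_sup_left.trans h)
    obtain ⟨L, hL, hLI, hz⟩ := h₂ (le_sup_right.trans h)
    exact ⟨J ⊔ L, Submodule.FG.sup hJ hL, sup_le hJI hLI, sup_le
      (hy.trans (mul_le_mul_left ((coeIdeal_le_coeIdeal K).2 le_sup_left) B))
      (hz.trans (mul_le_mul_left ((coeIdeal_le_coeIdeal K).2 le_sup_right) B))⟩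

/-- That 1 lies in `(II⁻¹)_t` is witnessed by a finitely generated part of `II⁻¹`, which involves
only finitely many elements of `I`. -/
lemma TInv.exists_fg {I : Ideal D} (hI : TInv (I : FractionalIdeal D⁰ K)) :
    ∃ J : Ideal D, J.FG ∧ J ≤ I ∧ (I : FractionalIdeal D⁰ K) ≤ tClosure (J : FractionalIdeal D⁰ K) := by
  obtain ⟨L, hL, hLf, h1⟩ := (mem_tClosure K).1 (FractionalIdeal.one_le.1 hI)
  obtain ⟨J, hJ, hJI, hLJ⟩ := exists_fg_le_of_le_mul hLf hL
  refine ⟨J, hJ, hJI, le_tClosure_of_mul_le (C := L)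
    (FractionalIdeal.one_le.2 ((mem_tClosure K).2 ⟨L, le_rfl, hLf, h1⟩)) ?_⟩
  calc (I : FractionalIdeal D⁰ K) * L
      ≤ I * ((J : FractionalIdeal D⁰ K) * (I : FractionalIdeal D⁰ K)⁻¹) := mul_le_mul_right (show L ≤ _ from hLJ) _
    _ = J * ((I : FractionalIdeal D⁰ K) * (I : FractionalIdeal D⁰ K)⁻¹) := mul_left_comm _ _ _
    _ ≤ J * 1 := mul_le_mul_right (mul_inv_le_one _) _
    _ = J := mul_one _
    _ ≤ tClosure J := le_tClosure _

lemma TInv.exists_pow_le {I J : Ideal D} (hJ : TInv (J : FractionalIdeal D⁰ K))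
    (h : J ≤ I.radical) : ∃ n : ℕ, (J : FractionalIdeal D⁰ K) ^ n ≤ tClosure (I : FractionalIdeal D⁰ K) := by
  obtain ⟨L, hL, hLJ, hJL⟩ := hJ.exists_fg
  obtain ⟨n, hn⟩ := Ideal.exists_pow_le_of_le_radical_of_fg (hLJ.trans h) hL
  refine ⟨n, (pow_le_pow_left' hJL n).trans ((tClosure_pow_le _ n).trans (tClosure_mono ?_))⟩
  rw [← coeIdeal_pow]
  exact (coeIdeal_le_coeIdeal K).2 hn

end PrimeTIdeals

/-! ### Height one primes -/

section HeightOne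

/-- A nonzero prime ideal that contains no smaller nonzero prime ideal. -/
structure IsHeightOne (P : Ideal D) : Prop where
  isPrime : P.IsPrime
  ne_bot : P ≠ ⊥
  eq_of_le : ∀ Q : Ideal D, Q.IsPrime → Q ≠ ⊥ → Q ≤ P → Q = P

lemma isHeightOne_iff_height {P : Ideal D} (hP : P.IsPrime) : IsHeightOne P ↔ P.height = 1 := by
  have h : P.height ≤ 1 ↔ ∀ Q : Ideal D, Q.IsPrime → Q < P → Q = ⊥ := by
    have := Ideal.height_le_iff (p := P) (n := 1)
    simpa [Order.lt_one_iff, Ideal.height_eq_zero_iff_eq_bot] using this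
  have h0 : 1 ≤ P.height ↔ P ≠ ⊥ := by
    rw [Order.one_le_iff_ne_zero, Ne, Ideal.height_eq_zero_iff_eq_bot]
  rw [le_antisymm_iff, h, h0]
  constructor
  · intro hP'
    refine ⟨fun Q hQ hQP => ?_, hP'.ne_bot⟩
    by_contra hQ0
    exact hQP.ne (hP'.eq_of_le Q hQ hQ0 hQP.le)
  · rintro ⟨h1, h2⟩
    refine ⟨hP, h2, fun Q hQ hQ0 hQP => ?_⟩
    by_contra hne
    exact hQ0 (h1 Q hQ (lt_of_le_of_ne hQP hne))

lemma IsHeightOne.mem_minimalPrimes {P I : Ideal D} (hP : IsHeightOne P) (hI : I ≠ ⊥)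
    (h : I ≤ P) : P ∈ I.minimalPrimes :=
  ⟨⟨hP.isPrime, h⟩, fun Q hQ hQP =>
    (hP.eq_of_le Q hQ.1 (fun h0 => hI (le_bot_iff.1 (h0 ▸ hQ.2))) hQP).ge⟩

lemma IsHeightOne.isTIdeal {P : Ideal D} (hP : IsHeightOne P) : IsTIdeal K P := by
  obtain ⟨a, ha, ha0⟩ := Submodule.exists_mem_ne_zero_of_ne_bot hP.ne_bot
  refine (isTIdeal_span_singleton K ha0).of_mem_minimalPrimes (hP.mem_minimalPrimes ?_ ?_)
  · simpa using ha0
  · exact (Ideal.span_singleton_le_iff_mem P).2 ha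

end HeightOne

/-! ### Factorization into `t`-invertible valuation ideals -/

section Factorization

variable (K) in
/-- A `t`-invertible valuation ideal. -/
def IsTInvValuationIdeal (I : Ideal D) : Prop :=
  TInv (I : FractionalIdeal D⁰ K) ∧ ∃ V : ValuationSubring K, (∀ d : D, algebraMap D K d ∈ V) ∧
    ∀ r : D, ∀ a ∈ I, V.valuation (algebraMap D K r) ≤ V.valuation (algebraMap D K a) → r ∈ I

lemma IsTInvValuationIdeal.exists_tVal {I : Ideal D} (hI : IsTInvValuationIdeal K I) :
    ∃ V : ValuationSubring K, (∀ d : D, algebraMap D K d ∈ V) ∧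
      TVal V (I : FractionalIdeal D⁰ K) := by
  obtain ⟨hinv, V, hV, h⟩ := hI
  refine ⟨V, hV, coeIdeal_le_one, hinv, fun r hr a ha hra => le_tClosure _ ?_⟩
  obtain ⟨r, rfl⟩ := (mem_one_iff D⁰).1 hr
  obtain ⟨b, hb, rfl⟩ := (mem_coeIdeal D⁰).1 ha
  exact algebraMap_mem_coeIdeal.2 (h r b hb hra)

lemma IsTInvValuationIdeal.ne_bot {I : Ideal D} (hI : IsTInvValuationIdeal K I) : I ≠ ⊥ :=
  coeIdeal_ne_zero.1 hI.1.ne_zero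

/-- If `v(x) ≤ v(y)` and `(xy)^n ∈ I`, then `v(x^(2n)) ≤ v((xy)^n)`, so `x^(2n) ∈ I`. -/
lemma IsTInvValuationIdeal.isPrime_radical {I : Ideal D} (hI : IsTInvValuationIdeal K I)
    (h1 : I ≠ ⊤) : I.radical.IsPrime := by
  obtain ⟨-, V, hV, h⟩ := hI
  have key : ∀ x y : D, V.valuation (algebraMap D K x) ≤ V.valuation (algebraMap D K y) →
      x * y ∈ I.radical → x ∈ I.radical := by
    rintro x y hxy ⟨n, hn⟩
    refine ⟨n + n, h _ _ hn ?_⟩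
    rw [pow_add, mul_pow, map_mul, map_mul, map_mul, map_mul]
    refine mul_le_mul_right ?_ _
    simpa only [map_pow] using pow_le_pow_left' hxy n
  refine ⟨fun h => h1 (Ideal.radical_eq_top.1 h), fun {x y} hxy => ?_⟩
  rcases le_total (V.valuation (algebraMap D K x)) (V.valuation (algebraMap D K y)) with h | h
  · exact .inl (key x y h hxy)
  · exact .inr (key y x h (mul_comm x y ▸ hxy))

lemma IsValuationIdeal.isTInvValuationIdeal {I : Ideal D} (hI : IsValuationIdeal K I)
    (hinv : TInv (I : FractionalIdeal D⁰ K)) : IsTInvValuationIdeal K I := by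
  obtain ⟨V, hV, h⟩ := hI
  refine ⟨hinv, V, hV, fun r a ha hra => (h r).1 ?_⟩
  have ha' : algebraMap D K a ∈ Submodule.span V (algebraMap D K '' (I : Set D)) :=
    Submodule.subset_span ⟨a, ha, rfl⟩
  obtain ⟨u, hu⟩ := (V.valuation_le_iff _ _).1 hra
  rw [← hu]
  exact Submodule.smul_mem _ u ha'

lemma IsTVIFD.exists_multiset (hD : IsTVIFD D K) {a : D} (ha : a ≠ 0) :
    ∃ S : Multiset (Ideal D), (∀ I ∈ S, IsTInvValuationIdeal K I) ∧
      spanSingleton D⁰ (algebraMap D K a) = tClosure ((S.prod : Ideal D) : FractionalIdeal D⁰ K) := by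
  classical
  obtain ⟨n, I, -, hI, h⟩ := hD a ha
  rw [coeIdeal_span_singleton] at h
  have ha' : algebraMap D K a ≠ 0 := by simpa using ha
  have hp : (((Finset.univ.val.map I).prod : Ideal D) : FractionalIdeal D⁰ K)
      = ∏ i, (I i : FractionalIdeal D⁰ K) := map_prod (coeIdealHom D⁰ K) I Finset.univ
  refine ⟨Finset.univ.val.map I, fun J hJ => ?_, by rw [hp, h]⟩
  obtain ⟨i, -, rfl⟩ := Multiset.mem_map.1 hJ
  -- The `t`-inverse of a factor is `a⁻¹` times the product of the others.
  refine (hI i).isTInvValuationIdeal (TInv.of_mul_le (B := spanSingleton D⁰ (algebraMap D K a)⁻¹ *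
    ∏ j ∈ Finset.univ.erase i, (I j : FractionalIdeal D⁰ K)) ?_ ?_)
  all_goals rw [mul_left_comm, Finset.mul_prod_erase _ (fun j => (I j : FractionalIdeal D⁰ K))
    (Finset.mem_univ i)]
  · calc _ ≤ spanSingleton D⁰ (algebraMap D K a)⁻¹ * spanSingleton D⁰ (algebraMap D K a) :=
          mul_le_mul_right (h ▸ le_tClosure _) _
      _ = 1 := by rw [spanSingleton_mul_spanSingleton, inv_mul_cancel₀ ha', spanSingleton_one]
  · calc 1 = spanSingleton D⁰ (algebraMap D K a)⁻¹ * spanSingleton D⁰ (algebraMap D K a) := by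
          rw [spanSingleton_mul_spanSingleton, inv_mul_cancel₀ ha', spanSingleton_one]
      _ ≤ _ := h ▸ mul_tClosure_le _ _

/-- `T` collects the factors not inside `P`; it becomes trivial in `D_P`. -/
lemma IsTVIFD.exists_split (hD : IsTVIFD D K) {P : Ideal D} (hP : P.IsPrime) {a : D} (ha : a ≠ 0) :
    ∃ (S : Multiset (Ideal D)) (T : Ideal D), (∀ I ∈ S, IsTInvValuationIdeal K I ∧ I ≤ P) ∧
      ¬ T ≤ P ∧ spanSingleton D⁰ (algebraMap D K a)
        = tClosure (((S.prod : Ideal D) : FractionalIdeal D⁰ K) * (T : FractionalIdeal D⁰ K)) := by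
  classical
  obtain ⟨S, hS, h⟩ := hD.exists_multiset ha
  refine ⟨S.filter (· ≤ P), (S.filter (¬ · ≤ P)).prod, fun I hI => ?_, fun hle => ?_, ?_⟩
  · exact ⟨hS I (Multiset.mem_of_mem_filter hI), (Multiset.mem_filter.1 hI).2⟩
  · obtain ⟨I, hI, hIP⟩ := hP.multiset_prod_le.1 hle
    exact (Multiset.mem_filter.1 hI).2 hIP
  · rw [h, ← coeIdeal_mul, ← Multiset.prod_add, Multiset.filter_add_not]

lemma IsTVIFD.exists_le (hD : IsTVIFD D K) {P : Ideal D} (hP : P.IsPrime) {a : D} (ha : a ≠ 0)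
    (haP : a ∈ P) : ∃ I : Ideal D, IsTInvValuationIdeal K I ∧ I ≤ P ∧
      algebraMap D K a ∈ tClosure (I : FractionalIdeal D⁰ K) := by
  obtain ⟨S, hS, h⟩ := hD.exists_multiset ha
  have hle : S.prod ≤ P := by
    rw [← coeIdeal_le_coeIdeal K]
    refine (le_tClosure _).trans (h.symm.trans_le ?_)
    rw [spanSingleton_le_iff_mem, algebraMap_mem_coeIdeal]
    exact haP
  obtain ⟨I, hI, hIP⟩ := hP.multiset_prod_le.1 hle
  refine ⟨I, hS I hI, hIP, ?_⟩
  rw [← spanSingleton_le_iff_mem, h]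
  refine tClosure_mono ((coeIdeal_le_coeIdeal K).2 ?_)
  exact Ideal.le_of_dvd (Multiset.dvd_prod hI)

lemma IsTInvValuationIdeal.radical_eq {I P : Ideal D} (hI : IsTInvValuationIdeal K I)
    (hP : IsHeightOne P) (h : I ≤ P) : I.radical = P :=
  hP.eq_of_le _ (hI.isPrime_radical fun h1 => hP.isPrime.ne_top (top_le_iff.1 (h1 ▸ h)))
    (fun h0 => hI.ne_bot (le_bot_iff.1 (h0 ▸ Ideal.le_radical)))
    (hP.isPrime.radical_le_iff.2 h)

/-- `V` comes from one arbitrary factor `J` inside `P`. Any other `I` has the same radical `P`, so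
`J^n ⊆ I_t` for some `n`, and `TVal.of_le` transfers `V` to `I`. -/
lemma IsTVIFD.exists_tVal_prod (hD : IsTVIFD D K) {P : Ideal D} (hP : IsHeightOne P) :
    ∃ V : ValuationSubring K, (∀ d : D, algebraMap D K d ∈ V) ∧
      ∀ S : Multiset (Ideal D), (∀ I ∈ S, IsTInvValuationIdeal K I ∧ I ≤ P) →
        TVal V ((S.prod : Ideal D) : FractionalIdeal D⁰ K) := by
  obtain ⟨a, ha, ha0⟩ := Submodule.exists_mem_ne_zero_of_ne_bot hP.ne_bot
  obtain ⟨J, hJ, hJP, -⟩ := hD.exists_le hP.isPrime ha0 ha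
  obtain ⟨V, hV, hJV⟩ := hJ.exists_tVal
  refine ⟨V, hV, fun S => ?_⟩
  induction S using Multiset.induction_on with
  | empty => intro _; simpa using tVal_one
  | cons I S ih =>
    intro h
    rw [Multiset.prod_cons, coeIdeal_mul]
    obtain ⟨hI, hIP⟩ := h I (Multiset.mem_cons_self I S)
    refine TVal.mul hV ?_ (ih fun L hL => h L (Multiset.mem_cons_of_mem hL))
    obtain ⟨n, hn⟩ := hJ.1.exists_pow_le (I := I) (hJP.trans_eq (hI.radical_eq hP hIP).symm)
    exact (hJV.pow hV n).of_le hV hI.1 coeIdeal_le_one hn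

end Factorization

/-! ### Localizations at height one primes and the Principal Ideal Theorem -/

section PrincipalIdealTheorem

lemma exists_notMem_mul_mem_span_of_le {P T T' : Ideal D} {a b : D} {A B : FractionalIdeal D⁰ K}
    (ha : spanSingleton D⁰ (algebraMap D K a) = tClosure (A * (T : FractionalIdeal D⁰ K)))
    (hb : spanSingleton D⁰ (algebraMap D K b) = tClosure (B * (T' : FractionalIdeal D⁰ K)))
    (hT' : ¬ T' ≤ P) (h : A ≤ tClosure B) : ∃ s ∉ P, s * a ∈ Ideal.span {b} := by
  obtain ⟨s, hs, hsP⟩ := SetLike.not_le_iff_exists.1 hT'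
  refine ⟨s, hsP, ?_⟩
  rw [← algebraMap_mem_coeIdeal (K := K), coeIdeal_span_singleton, hb, map_mul]
  have h1 : (T' : FractionalIdeal D⁰ K) * (A * (T : FractionalIdeal D⁰ K))
      ≤ tClosure (B * (T' : FractionalIdeal D⁰ K)) :=
    calc (T' : FractionalIdeal D⁰ K) * (A * (T : FractionalIdeal D⁰ K))
        ≤ T' * (tClosure B * 1) := mul_le_mul_right (mul_le_mul' h coeIdeal_le_one) _
      _ = tClosure B * T' := by rw [mul_one, mul_comm]
      _ ≤ _ := tClosure_mul_le _ _
  refine tClosure_le_of_le h1 (mul_tClosure_le _ _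
    (mul_mem_mul (algebraMap_mem_coeIdeal.2 hs) ?_))
  rw [← ha]
  exact mem_spanSingleton_self _ _

/-- The localization at a height one prime of a `t`-VIFD is a valuation ring. -/
lemma IsTVIFD.exists_notMem_mul_mem_span (hD : IsTVIFD D K) {P : Ideal D} (hP : IsHeightOne P)
    (a b : D) : ∃ s ∉ P, s * a ∈ Ideal.span {b} ∨ s * b ∈ Ideal.span {a} := by
  have h1 : (1 : D) ∉ P := fun h => hP.isPrime.ne_top ((Ideal.eq_top_iff_one P).2 h)
  by_cases ha : a = 0
  · exact ⟨1, h1, by simp [ha]⟩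
  by_cases hb : b = 0
  · exact ⟨1, h1, by simp [hb]⟩
  obtain ⟨V, hV, hVP⟩ := hD.exists_tVal_prod hP
  obtain ⟨S, T, hS, hT, haS⟩ := hD.exists_split hP.isPrime ha
  obtain ⟨S', T', hS', hT', hbS⟩ := hD.exists_split hP.isPrime hb
  rcases (hVP S hS).le_total (hVP S' hS') with h | h
  · obtain ⟨s, hs, hsa⟩ := exists_notMem_mul_mem_span_of_le haS hbS hT' h
    exact ⟨s, hs, .inl hsa⟩
  · obtain ⟨s, hs, hsa⟩ := exists_notMem_mul_mem_span_of_le hbS haS hT h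
    exact ⟨s, hs, .inr hsa⟩

lemma SatisfiesPIT.isHeightOne (h : SatisfiesPIT D) {a : D} (ha : a ≠ 0) {P : Ideal D}
    (hP : P ∈ (Ideal.span {a}).minimalPrimes) : IsHeightOne P :=
  (isHeightOne_iff_height hP.1.1).2 (h a ha P hP)

/-- The Principal Ideal Theorem extends to `t`-invertible `t`-ideals. -/
lemma SatisfiesPIT.isHeightOne_of_tInv (h : SatisfiesPIT D) {I T Q : Ideal D}
    (hI : TInv (I : FractionalIdeal D⁰ K))
    (hT : (T : FractionalIdeal D⁰ K) = tClosure (I : FractionalIdeal D⁰ K))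
    (hQ : Q ∈ T.minimalPrimes) : IsHeightOne Q := by
  have hI0 : I ≠ ⊥ := coeIdeal_ne_zero.1 hI.ne_zero
  have hIT : I ≤ T := (coeIdeal_le_coeIdeal K).1 (hT ▸ le_tClosure _)
  have hQt : IsTIdeal K Q := (isTIdeal_of_coe_eq_tClosure hI0 hT).of_mem_minimalPrimes hQ
  obtain ⟨q, hq, s, hs, hsI⟩ := hI.exists_mul_eq hQt hQ.1.1.ne_top
  rw [← hT] at hsI
  have hq0 : q ≠ 0 := by
    rintro rfl
    obtain ⟨i, hi, hi0⟩ := Submodule.exists_mem_ne_zero_of_ne_bot hI0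
    obtain ⟨c, hc⟩ := hsI i (algebraMap_mem_coeIdeal.2 (hIT hi))
    rw [zero_mul] at hc
    exact (mul_ne_zero (fun h0 : s = 0 => hs (h0 ▸ Q.zero_mem)) hi0) hc
  -- Since `q` generates `T` locally at `Q`, the prime `Q` is also minimal over `q`.
  refine h.isHeightOne hq0 ⟨⟨hQ.1.1, ?_⟩, fun Q' hQ' hQQ' => hQ.2 ⟨hQ'.1, fun x hx => ?_⟩ hQQ'⟩
  · exact (Ideal.span_singleton_le_iff_mem Q).2 (hQ.1.2 (hIT hq))
  · obtain ⟨c, hc⟩ := hsI x (algebraMap_mem_coeIdeal.2 hx)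
    have : s * x ∈ Q' :=
      hc ▸ Q'.mul_mem_right c ((Ideal.span_singleton_le_iff_mem Q').1 hQ'.2)
    exact (hQ'.1.mem_or_mem this).resolve_left fun h => hs (hQQ' h)

lemma SatisfiesPIT.exists_isHeightOne (h : SatisfiesPIT D) {I : Ideal D}
    (hI : TInv (I : FractionalIdeal D⁰ K)) (h1 : ¬ 1 ≤ tClosure (I : FractionalIdeal D⁰ K)) :
    ∃ Q : Ideal D, IsHeightOne Q ∧ I ≤ Q := by
  obtain ⟨T, hT⟩ := exists_coeIdeal_eq_tClosure K I
  have hT1 : T ≠ ⊤ := by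
    rintro rfl
    exact h1 (by rw [← hT, coeIdeal_top])
  obtain ⟨Q, hQ⟩ := Ideal.nonempty_minimalPrimes hT1
  exact ⟨Q, h.isHeightOne_of_tInv hI hT hQ,
    ((coeIdeal_le_coeIdeal K).1 (hT ▸ le_tClosure _)).trans hQ.1.2⟩

/-- Under the Principal Ideal Theorem, the `t`-closure of a `t`-invertible valuation ideal inside
a height one prime `P` is `P`-primary. -/
lemma IsTVIFD.mem_tClosure_of_mul_mem (hD : IsTVIFD D K) (h : SatisfiesPIT D) {P J : Ideal D}
    (hP : IsHeightOne P) (hJ : IsTInvValuationIdeal K J) (hJP : J ≤ P) {r s : D} (hs : s ∉ P)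
    (hsr : algebraMap D K (s * r) ∈ tClosure (J : FractionalIdeal D⁰ K)) :
    algebraMap D K r ∈ tClosure (J : FractionalIdeal D⁰ K) := by
  by_cases hr : r = 0
  · rw [hr, map_zero]
    exact (tClosure (J : FractionalIdeal D⁰ K)).1.zero_mem
  obtain ⟨V, hV, hVP⟩ := hD.exists_tVal_prod hP
  obtain ⟨S, T, hS, hT, hrS⟩ := hD.exists_split hP.isPrime hr
  have hA := hVP S hS
  have hJV := hVP {J} (by simpa using ⟨hJ, hJP⟩)
  rw [Multiset.prod_singleton] at hJV
  generalize ((S.prod : Ideal D) : FractionalIdeal D⁰ K) = A at hrS hA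
  suffices hAJ : A ≤ tClosure (J : FractionalIdeal D⁰ K) by
    have h1 : A * (T : FractionalIdeal D⁰ K) ≤ tClosure (J : FractionalIdeal D⁰ K) :=
      (mul_le_of_le_one_right' coeIdeal_le_one).trans hAJ
    exact tClosure_le_of_le h1 (hrS ▸ mem_spanSingleton_self _ _)
  -- When `J ⊆ A_t`, the quotient `C = JA⁻¹` is integral and `t`-invertible. If `C_t = D` then `A ⊆
  -- J_t`; otherwise `C` lies in a height one prime `Q`.
  refine (hA.le_total hJV).elim id fun hJA => ?_
  have hC1 : (J : FractionalIdeal D⁰ K) * A⁻¹ ≤ 1 :=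
    (mul_le_mul_left hJA _).trans (tClosure_mul_inv_le_one A)
  have hC : TInv ((J : FractionalIdeal D⁰ K) * A⁻¹) := hJ.1.mul hA.tInv.inv
  obtain ⟨C, hCe⟩ := le_one_iff_exists_coeIdeal.1 hC1
  by_cases hC' : 1 ≤ tClosure ((J : FractionalIdeal D⁰ K) * A⁻¹)
  · refine le_tClosure_of_mul_le hC' ?_
    calc A * ((J : FractionalIdeal D⁰ K) * A⁻¹) = J * (A * A⁻¹) := mul_left_comm _ _ _
      _ ≤ J := mul_le_of_le_one_right' (mul_inv_le_one A)
      _ ≤ tClosure J := le_tClosure _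
  exfalso
  rw [← hCe] at hC'
  obtain ⟨Q, hQ, hCQ⟩ := h.exists_isHeightOne (hCe ▸ hC) hC'
  have hJQ : J ≤ Q := by
    rw [← coeIdeal_le_coeIdeal K]
    refine le_trans ?_ (hQ.isTIdeal.tClosure_le ((coeIdeal_le_coeIdeal K).2 hCQ))
    refine le_tClosure_of_mul_le hA.tInv ?_
    calc (J : FractionalIdeal D⁰ K) * (A * A⁻¹) = C * A := by rw [hCe]; ring
      _ ≤ C := mul_le_of_le_one_right' hA.le_one
      _ ≤ tClosure C := le_tClosure _
  obtain rfl : P = Q := (hJ.radical_eq hP hJP).symm.trans (hJ.radical_eq hQ hJQ)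
  -- As `P = Q`, dividing `sr ∈ J_t` by `A` gives `sT ⊆ C_t ⊆ P`, although `s ∉ P` and `T ⊄ P`.
  have hle : spanSingleton D⁰ (algebraMap D K s) * (T : FractionalIdeal D⁰ K) ≤ P := by
    rw [← hP.isTIdeal.2]
    refine le_tClosure_of_mul_le hA.tInv ?_
    calc spanSingleton D⁰ (algebraMap D K s) * (T : FractionalIdeal D⁰ K) * (A * A⁻¹)
        = spanSingleton D⁰ (algebraMap D K s) * (A * T) * A⁻¹ := by ring
      _ ≤ spanSingleton D⁰ (algebraMap D K s) * spanSingleton D⁰ (algebraMap D K r) * A⁻¹ :=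
        mul_le_mul_left (mul_le_mul_right (hrS ▸ le_tClosure _) _) _
      _ ≤ tClosure (J : FractionalIdeal D⁰ K) * A⁻¹ := by
        refine mul_le_mul_left ?_ _
        rw [spanSingleton_mul_spanSingleton, ← map_mul]
        exact spanSingleton_le_iff_mem.2 hsr
      _ ≤ tClosure ((J : FractionalIdeal D⁰ K) * A⁻¹) := tClosure_mul_le _ _
      _ ≤ tClosure (P : FractionalIdeal D⁰ K) :=
        tClosure_mono (hCe ▸ (coeIdeal_le_coeIdeal K).2 hCQ)
  refine hT fun t ht => ?_
  have h2 := hle (mul_mem_mul (mem_spanSingleton_self _ _)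
    (algebraMap_mem_coeIdeal (K := K).2 ht))
  rw [← map_mul, algebraMap_mem_coeIdeal] at h2
  exact (hP.isPrime.mem_or_mem h2).resolve_left hs

/-- Primariness puts `r` in `I_t` for the first factor `I`. Then `rI⁻¹ ⊆ D` inherits the local
condition for the remaining product, so induction applies to its elements. -/
lemma IsTVIFD.mem_tClosure_prod (hD : IsTVIFD D K) (h : SatisfiesPIT D)
    (S : Multiset (Ideal D)) (hS : ∀ I ∈ S, IsTInvValuationIdeal K I) (r : D)
    (hr : ∀ P : Ideal D, IsHeightOne P → ∃ s ∉ P,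
      algebraMap D K (s * r) ∈ tClosure ((S.prod : Ideal D) : FractionalIdeal D⁰ K)) :
    algebraMap D K r ∈ tClosure ((S.prod : Ideal D) : FractionalIdeal D⁰ K) := by
  induction S using Multiset.induction_on generalizing r with
  | empty =>
    rw [Multiset.prod_zero, Ideal.one_eq_top, coeIdeal_top, tClosure_one]
    exact (mem_one_iff D⁰).2 ⟨r, rfl⟩
  | cons I S ih =>
    obtain ⟨hI, hS⟩ := Multiset.forall_mem_cons.1 hS
    rw [Multiset.prod_cons, coeIdeal_mul] at hr ⊢
    have hrI : algebraMap D K r ∈ tClosure (I : FractionalIdeal D⁰ K) := by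
      by_cases h1 : 1 ≤ tClosure (I : FractionalIdeal D⁰ K)
      · exact h1 ((mem_one_iff D⁰).2 ⟨r, rfl⟩)
      · obtain ⟨Q, hQ, hIQ⟩ := h.exists_isHeightOne hI.1 h1
        obtain ⟨s, hs, hsr⟩ := hr Q hQ
        exact hD.mem_tClosure_of_mul_mem h hQ hI hIQ hs
          (tClosure_mono (mul_le_of_le_one_right' coeIdeal_le_one) hsr)
    rw [mul_comm]
    refine hI.1.spanSingleton_mul_inv_le (spanSingleton_mul_le_iff.2 fun y hy => ?_)
    obtain ⟨e, he⟩ := exists_eq_algebraMap (tClosure_mul_inv_le_one _) (mul_mem_mul hrI hy)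
    rw [← he]
    refine ih hS e fun P hP => ?_
    obtain ⟨s, hs, hsr⟩ := hr P hP
    refine ⟨s, hs, ?_⟩
    rw [map_mul, he, ← mul_assoc, ← map_mul]
    refine tClosure_mono ?_ (tClosure_mul_le _ _ (mul_mem_mul hsr hy))
    rw [mul_right_comm]
    exact mul_le_of_le_one_left' (mul_inv_le_one _)

/-- Under the Principal Ideal Theorem, `D` is the intersection of its localizations at height one
primes. -/
lemma IsTVIFD.mem_span_singleton (hD : IsTVIFD D K) (h : SatisfiesPIT D) {a b : D} (hb : b ≠ 0)
    (hab : ∀ P : Ideal D, IsHeightOne P → ∃ s ∉ P, s * a ∈ Ideal.span {b}) :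
    a ∈ Ideal.span {b} := by
  obtain ⟨S, hS, hbS⟩ := hD.exists_multiset hb
  rw [← algebraMap_mem_coeIdeal (K := K), coeIdeal_span_singleton, hbS]
  refine hD.mem_tClosure_prod h S hS a fun P hP => ?_
  obtain ⟨s, hs, hsa⟩ := hab P hP
  refine ⟨s, hs, ?_⟩
  rwa [← hbS, ← coeIdeal_span_singleton, algebraMap_mem_coeIdeal]

lemma IsTVIFD.finite_isHeightOne (hD : IsTVIFD D K) {a : D} (ha : a ≠ 0) :
    {P : Ideal D | IsHeightOne P ∧ a ∈ P}.Finite := by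
  classical
  obtain ⟨S, hS, h⟩ := hD.exists_multiset ha
  refine (S.toFinset.image Ideal.radical).finite_toSet.subset ?_
  rintro P ⟨hP, haP⟩
  have hle : S.prod ≤ P := by
    rw [← coeIdeal_le_coeIdeal K]
    refine (le_tClosure _).trans (h.symm.trans_le ?_)
    rw [spanSingleton_le_iff_mem, algebraMap_mem_coeIdeal]
    exact haP
  obtain ⟨I, hI, hIP⟩ := hP.isPrime.multiset_prod_le.1 hle
  simp only [Finset.coe_image, Set.mem_image, Finset.mem_coe, Multiset.mem_toFinset]
  exact ⟨I, hI, (hS I hI).radical_eq hP hIP⟩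

/-- Otherwise prime avoidance gives `b ∈ Q` outside the finitely many height one primes containing
`a`. No height one prime contains both, so `D = ⋂ D_P` gives `(a,b)⁻¹ = D`. Then 1 lies in `(a,b)_v
⊆ Q`. -/
lemma IsTVIFD.isHeightOne_of_isTIdeal (hD : IsTVIFD D K) (h : SatisfiesPIT D) {Q : Ideal D}
    (hQ : Q.IsPrime) (hQt : IsTIdeal K Q) : IsHeightOne Q := by
  classical
  by_contra hne
  obtain ⟨a, ha, ha0⟩ := Submodule.exists_mem_ne_zero_of_ne_bot hQt.1
  have hfin := hD.finite_isHeightOne ha0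
  have hnot : ¬ (Q : Set D) ⊆ ⋃ P ∈ (hfin.toFinset : Set (Ideal D)), (P : Set D) := by
    rw [Ideal.subset_union_prime (f := fun P : Ideal D => P) ⊥ ⊥
      fun P hP _ _ => ((hfin.mem_toFinset).1 hP).1.isPrime]
    rintro ⟨P, hP, hQP⟩
    have hP1 := ((hfin.mem_toFinset).1 hP).1
    exact hne (hP1.eq_of_le Q hQ hQt.1 hQP ▸ hP1)
  obtain ⟨b, hb, hbP⟩ := Set.not_subset.1 hnot
  simp only [Set.mem_iUnion, not_exists] at hbP
  have hJQ : Ideal.span {a, b} ≤ Q := Ideal.span_le.2 (by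
    rintro x (rfl | rfl)
    exacts [ha, hb])
  have haJ : a ∈ Ideal.span {a, b} := Ideal.subset_span (by simp)
  have hbJ : b ∈ Ideal.span {a, b} := Ideal.subset_span (by simp)
  have hJ0 : ((Ideal.span {a, b} : Ideal D) : FractionalIdeal D⁰ K) ≠ 0 :=
    coeIdeal_ne_zero.2 fun h0 => ha0 (by rw [h0] at haJ; exact haJ)
  refine not_one_le_coeIdeal (K := K) hQ.ne_top (FractionalIdeal.one_le.2 ?_)
  refine hQt.tClosure_le ((coeIdeal_le_coeIdeal K).2 hJQ) ((mem_tClosure K).2 ⟨_, le_rfl, ?_, ?_⟩)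
  · exact (coeIdeal_fg D⁰ (IsFractionRing.injective D K) _).2 ⟨{a, b}, by simp [Ideal.span]⟩
  · refine (mem_inv_iff (inv_ne_zero' hJ0)).2 fun y hy => ?_
    rw [one_mul]
    obtain ⟨c, d, hd, rfl⟩ := IsFractionRing.div_surjective (A := D) y
    have hd0 : d ≠ 0 := nonZeroDivisors.ne_zero hd
    have hd0' : algebraMap D K d ≠ 0 := by simpa using hd0
    have key : ∀ e ∈ Ideal.span {a, b}, e * c ∈ Ideal.span {d} := by
      intro e he
      obtain ⟨f, hf⟩ := (mem_one_iff D⁰).1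
        ((mem_inv_iff hJ0).1 hy _ (algebraMap_mem_coeIdeal.2 he))
      refine Ideal.mem_span_singleton'.2 ⟨f, IsFractionRing.injective D K ?_⟩
      rw [map_mul, map_mul, hf]
      field_simp
    obtain ⟨g, hg⟩ := Ideal.mem_span_singleton'.1 (hD.mem_span_singleton h hd0 fun P hP => by
      by_cases haP : a ∈ P
      · refine ⟨b, fun hb' => hbP P ?_ hb', key b hbJ⟩
        exact (hfin.mem_toFinset).2 ⟨hP, haP⟩
      · exact ⟨a, haP, key a haJ⟩)
    refine (mem_one_iff D⁰).2 ⟨g, ?_⟩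
    rw [← hg, map_mul]
    field_simp

lemma IsTVIFD.exists_forall_mul_mem_span (hD : IsTVIFD D K) {P : Ideal D} (hP : IsHeightOne P)
    {I : Ideal D} (hI : I.FG) : ∃ x ∈ I, ∃ s ∉ P, ∀ i ∈ I, s * i ∈ Ideal.span {x} := by
  induction I, hI using Submodule.fg_induction with
  | singleton x =>
    exact ⟨x, Submodule.mem_span_singleton_self x, 1,
      fun h => hP.isPrime.ne_top ((Ideal.eq_top_iff_one P).2 h), fun i hi => by rwa [one_mul]⟩
  | sup I₁ I₂ _ _ h₁ h₂ =>
    obtain ⟨x, hx, s, hs, hsx⟩ := h₁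
    obtain ⟨y, hy, t, ht, hty⟩ := h₂
    have key : ∀ (J₁ J₂ : Ideal D) (x y s t u : D), y ∈ J₂ → s ∉ P → t ∉ P → u ∉ P →
        (∀ i ∈ J₁, s * i ∈ Ideal.span {x}) → (∀ i ∈ J₂, t * i ∈ Ideal.span {y}) →
        u * x ∈ Ideal.span {y} →
        ∃ x ∈ J₁ ⊔ J₂, ∃ s ∉ P, ∀ i ∈ J₁ ⊔ J₂, s * i ∈ Ideal.span {x} := by
      intro J₁ J₂ x y s t u hy hs ht hu hsx hty hux
      refine ⟨y, Submodule.mem_sup_right hy, u * s * t, fun h => ?_, fun i hi => ?_⟩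
      · exact (hP.isPrime.mem_or_mem h).elim (fun h => (hP.isPrime.mem_or_mem h).elim hu hs) ht
      · obtain ⟨j, hj, k, hk, rfl⟩ := Submodule.mem_sup.1 hi
        rw [show u * s * t * (j + k) = t * (u * (s * j)) + u * s * (t * k) by ring]
        refine Ideal.add_mem _ (Ideal.mul_mem_left _ _ ?_) (Ideal.mul_mem_left _ _ (hty k hk))
        obtain ⟨c, hc⟩ := Ideal.mem_span_singleton'.1 (hsx j hj)
        rw [← hc, mul_left_comm]
        exact Ideal.mul_mem_left _ _ hux
    obtain ⟨u, hu, h | h⟩ := hD.exists_notMem_mul_mem_span hP x y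
    · exact key _ _ x y s t u hy hs ht hu hsx hty h
    · rw [sup_comm]
      exact key _ _ y x t s u hx ht hs hu hty hsx h

/-- If `(II⁻¹)_t` is proper, a minimal prime `Q` over it has height one. There `I` is generated by
some `x`, so `s/x ∈ I⁻¹` for some `s ∉ Q`, yet `s ∈ II⁻¹ ⊆ Q`. -/
lemma IsTVIFD.isPvMD (hD : IsTVIFD D K) (h : SatisfiesPIT D) : IsPvMD D K := by
  intro I hI0 hI
  rw [isTInvertible_iff]
  by_contra hinv
  have hI0' : (I : FractionalIdeal D⁰ K) ≠ 0 := coeIdeal_ne_zero.2 hI0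
  obtain ⟨W, hW⟩ := le_one_iff_exists_coeIdeal.1 (mul_inv_le_one (I : FractionalIdeal D⁰ K))
  obtain ⟨T, hT⟩ := exists_coeIdeal_eq_tClosure K W
  have hT1 : T ≠ ⊤ := by
    rintro rfl
    exact hinv (by rw [TInv, ← hW, ← hT, coeIdeal_top])
  have hW0 : W ≠ ⊥ := by
    rw [← coeIdeal_ne_zero (K := K), hW]
    exact (bot_lt_mul_inv hI0').ne'
  obtain ⟨Q, hQ⟩ := Ideal.nonempty_minimalPrimes hT1
  have hQ1 := hD.isHeightOne_of_isTIdeal h hQ.1.1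
    ((isTIdeal_of_coe_eq_tClosure hW0 hT).of_mem_minimalPrimes hQ)
  obtain ⟨x, hx, s, hs, hsx⟩ := hD.exists_forall_mul_mem_span hQ1 hI
  have hx0 : x ≠ 0 := by
    rintro rfl
    obtain ⟨i, hi, hi0⟩ := Submodule.exists_mem_ne_zero_of_ne_bot hI0
    have := hsx i hi
    rw [Ideal.mem_span_singleton, zero_dvd_iff] at this
    exact mul_ne_zero (fun h0 : s = 0 => hs (h0 ▸ Q.zero_mem)) hi0 this
  have hx0' : algebraMap D K x ≠ 0 := by simpa using hx0
  have hy : algebraMap D K s / algebraMap D K x ∈ (I : FractionalIdeal D⁰ K)⁻¹ := by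
    refine (mem_inv_iff hI0').2 fun z hz => ?_
    obtain ⟨i, hi, rfl⟩ := (mem_coeIdeal D⁰).1 hz
    obtain ⟨c, hc⟩ := Ideal.mem_span_singleton'.1 (hsx i hi)
    refine (mem_one_iff D⁰).2 ⟨c, ?_⟩
    rw [div_mul_eq_mul_div, ← map_mul, ← hc, map_mul, mul_div_cancel_right₀ _ hx0']
  have hsW : algebraMap D K s ∈ (W : FractionalIdeal D⁰ K) := by
    rw [hW]
    have := mul_mem_mul (algebraMap_mem_coeIdeal (K := K).2 hx) hy
    rwa [mul_div_cancel₀ _ hx0'] at this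
  exact hs (hQ.1.2 (algebraMap_mem_coeIdeal.1 (hT ▸ le_tClosure _ hsW)))

lemma IsTVIFD.tDim_le_one (hD : IsTVIFD D K) (h : SatisfiesPIT D) : tDim D K ≤ 1 := by
  refine iSup₂_le fun n ⟨P, hP, hPt⟩ => ?_
  by_contra hn
  have hn : 1 < n := by exact_mod_cast not_le.1 hn
  have hlt : P ⟨0, by lia⟩ < P ⟨1, hn⟩ := hP (by simp)
  have h1 := hD.isHeightOne_of_isTIdeal h (hPt ⟨1, hn⟩).1 (hPt ⟨1, hn⟩).2
  exact hlt.ne (h1.eq_of_le _ (hPt _).1 (hPt _).2.1 hlt.le)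

lemma IsTVIFD.hasFiniteTCharacter (hD : IsTVIFD D K) (h : SatisfiesPIT D) :
    HasFiniteTCharacter D K := by
  intro a ha _
  refine (hD.finite_isHeightOne ha).subset ?_
  rintro M ⟨hM, haM⟩
  obtain ⟨Q, hQ⟩ := Ideal.nonempty_minimalPrimes hM.1.2
  have hQt := hM.1.1.of_mem_minimalPrimes hQ
  -- A minimal prime over `M` is a proper `t`-ideal, so maximality makes `M` prime.
  obtain rfl : M = Q := le_antisymm hQ.1.2 (hM.2 ⟨hQt, hQ.1.1.ne_top⟩ hQ.1.2)
  exact ⟨hD.isHeightOne_of_isTIdeal h hQ.1.1 hQt, haM⟩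

lemma IsTVIFD.isGeneralizedKrullDomain (hD : IsTVIFD D K) (h : SatisfiesPIT D) :
    IsGeneralizedKrullDomain D K :=
  ⟨hD.isPvMD h, hD.tDim_le_one h, hD.hasFiniteTCharacter h⟩

lemma IsTVIFD.isCompletelyIntegrallyClosed (hD : IsTVIFD D K) (h : SatisfiesPIT D) :
    IsCompletelyIntegrallyClosed D K := by
  rintro x ⟨c, hc, hcx⟩
  have hc0 : c ≠ 0 := nonZeroDivisors.ne_zero hc
  obtain ⟨a, b, hb, rfl⟩ := IsFractionRing.div_surjective (A := D) x
  have hb0 : b ≠ 0 := nonZeroDivisors.ne_zero hb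
  have hb0' : algebraMap D K b ≠ 0 := by simpa using hb0
  have hab : ∀ m : ℕ, ∃ f, f * b ^ m = c * a ^ m := by
    intro m
    obtain ⟨f, hf⟩ := hcx m
    refine ⟨f, IsFractionRing.injective D K ?_⟩
    rw [map_mul, hf, Algebra.smul_def, map_mul, map_pow, map_pow, mul_assoc, ← mul_pow,
      div_mul_cancel₀ _ hb0']
  obtain ⟨g, hg⟩ := Ideal.mem_span_singleton'.1 (hD.mem_span_singleton h hb0 (a := a)
    fun P hP => by
      obtain ⟨s, hs, hsab | hsab⟩ := hD.exists_notMem_mul_mem_span hP a b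
      · exact ⟨s, hs, hsab⟩
      obtain ⟨e, he⟩ := Ideal.mem_span_singleton'.1 hsab
      refine ⟨e, fun heP => ?_, he ▸ Ideal.mul_mem_left _ _ (Ideal.mem_span_singleton_self b)⟩
      obtain ⟨t, ht, n, htn⟩ : ∃ t ∉ P, ∃ n : ℕ, t * e ^ n ∈ Ideal.span {c} := by
        by_cases hcP : c ∈ P
        · refine exists_notMem_mul_pow_mem (hP.mem_minimalPrimes ?_ ?_) heP
          · simpa using hc0
          · exact (Ideal.span_singleton_le_iff_mem P).2 hcP
        · exact ⟨c, hcP, 0, by simp⟩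
      obtain ⟨g, hg⟩ := Ideal.mem_span_singleton'.1 htn
      -- The exponent `n + 1` leaves a spare factor `e ∈ P` after `e ^ n` absorbs `c`.
      obtain ⟨f, hf⟩ := hab (n + 1)
      have h1 : t * s ^ (n + 1) = f * g * e := by
        refine mul_right_cancel₀ (mul_ne_zero hc0 (pow_ne_zero (n + 1) hb0)) ?_
        calc t * s ^ (n + 1) * (c * b ^ (n + 1)) = t * c * (s * b) ^ (n + 1) := by ring
          _ = t * e ^ n * e * (c * a ^ (n + 1)) := by rw [← he]; ring
          _ = f * g * e * (c * b ^ (n + 1)) := by rw [← hg, ← hf]; ring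
      have h2 : t * s ^ (n + 1) ∈ P := h1 ▸ P.mul_mem_left _ heP
      exact (hP.isPrime.mem_or_mem h2).elim ht fun h => hs (hP.isPrime.mem_of_pow_mem _ h))
  refine ⟨g, ?_⟩
  rw [← hg, map_mul]
  field_simp

end PrincipalIdealTheorem

/-! ### The remaining implications -/

section Implications

lemma satisfiesPIT_of_tDim_le_one (h : tDim D K ≤ 1) : SatisfiesPIT D := by
  intro a ha P hP
  have hPt := (isTIdeal_span_singleton K ha).of_mem_minimalPrimes hP
  refine (isHeightOne_iff_height hP.1.1).1 ⟨hP.1.1, hPt.1, fun Q hQ hQ0 hQP => ?_⟩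
  by_contra hne
  obtain ⟨b, hb, hb0⟩ := Submodule.exists_mem_ne_zero_of_ne_bot hQ0
  -- `Q` may fail to be a `t`-ideal, but a minimal prime `R` over `b` inside it is one.
  obtain ⟨R, hR, hRQ⟩ := Ideal.exists_minimalPrimes_le ((Ideal.span_singleton_le_iff_mem Q).2 hb)
  have hlt : R < P := hRQ.trans_lt (lt_of_le_of_ne hQP hne)
  have hRt := (isTIdeal_span_singleton K hb0).of_mem_minimalPrimes hR
  have h2 : ((2 : ℕ) : ℕ∞) ≤ tDim D K := by
    refine le_iSup₂_of_le (f := fun (n : ℕ) (_ : ∃ P : Fin n → Ideal D, StrictMono P ∧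
      ∀ i, IsPrimeTIdeal K (P i)) => (n : ℕ∞)) 2 ⟨![R, P], ?_, ?_⟩ le_rfl
    · simpa using hlt
    · simpa [Fin.forall_fin_two] using
        (⟨⟨hR.1.1, hRt⟩, ⟨hP.1.1, hPt⟩⟩ : IsPrimeTIdeal K R ∧ IsPrimeTIdeal K P)
  have := h2.trans h
  norm_cast at this

lemma IsCompletelyIntegrallyClosed.iInter_tClosure_pow (h : IsCompletelyIntegrallyClosed D K)
    {I : Ideal D} (hI1 : I ≠ ⊤) (hIt : IsTIdeal K I) (hI : IsTInvertible K I) :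
    (⋂ (n : ℕ) (_ : 1 ≤ n), (tClosure ((I : FractionalIdeal D⁰ K) ^ n) : Set K)) = {0} := by
  refine Set.eq_singleton_iff_unique_mem.2 ⟨?_, fun x hx => ?_⟩
  · simp only [Set.mem_iInter]
    exact fun n _ => (tClosure ((I : FractionalIdeal D⁰ K) ^ n)).1.zero_mem
  by_contra hx0
  have hx' : ∀ n : ℕ, x ∈ tClosure ((I : FractionalIdeal D⁰ K) ^ (n + 1)) := fun n =>
    Set.mem_iInter₂.1 hx (n + 1) (by lia)
  have hpow : ∀ n : ℕ, tClosure ((I : FractionalIdeal D⁰ K) ^ n) * ((I : FractionalIdeal D⁰ K)⁻¹) ^ n ≤ 1 := by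
    intro n
    refine (tClosure_mul_le _ _).trans (tClosure_le_one ?_)
    rw [← mul_pow]
    exact pow_le_one' (mul_inv_le_one _) n
  obtain ⟨c, rfl⟩ := exists_eq_algebraMap (tClosure_le_one (pow_le_one' coeIdeal_le_one _)) (hx' 0)
  have hc0 : c ≠ 0 := by
    rintro rfl
    exact hx0 (map_zero _)
  have hinv : (I : FractionalIdeal D⁰ K)⁻¹ ≤ 1 := by
    intro y hy
    refine (mem_one_iff D⁰).2 (h y ⟨c, mem_nonZeroDivisors_of_ne_zero hc0, fun n => ?_⟩)
    rw [Algebra.smul_def]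
    -- Almost integrality includes the exponent 0, which the intersection over `n ≥ 1` does not
    -- cover.
    rcases n with _ | n
    · exact ⟨c, by simp⟩
    · refine (mem_one_iff D⁰).1 (hpow (n + 1) (mul_mem_mul (hx' n) ?_))
      rw [← spanSingleton_le_iff_mem, ← spanSingleton_pow]
      exact pow_le_pow_left' (spanSingleton_le_iff_mem.2 hy) _
  refine not_one_le_coeIdeal (K := K) hI1 (hI.2.ge.trans (hIt.tClosure_le ?_))
  exact mul_le_of_le_one_right' hinv

lemma IsTVIFD.satisfiesPIT (hD : IsTVIFD D K)
    (h : ∀ I : Ideal D, I ≠ ⊤ → IsTIdeal K I → IsTInvertible K I →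
      (⋂ (n : ℕ) (_ : 1 ≤ n), (tClosure ((I : FractionalIdeal D⁰ K) ^ n) : Set K)) = {0}) :
    SatisfiesPIT D := by
  intro a ha P hP
  have hPt := (isTIdeal_span_singleton K ha).of_mem_minimalPrimes hP
  have haP : a ∈ P := (Ideal.span_singleton_le_iff_mem P).1 hP.1.2
  refine (isHeightOne_iff_height hP.1.1).1 ⟨hP.1.1, hPt.1, fun Q' hQ' hQ0' hQP' => ?_⟩
  by_contra hne
  obtain ⟨b, hb', hb0⟩ := Submodule.exists_mem_ne_zero_of_ne_bot hQ0'
  obtain ⟨Q, hQ, hQQ'⟩ := Ideal.exists_minimalPrimes_le ((Ideal.span_singleton_le_iff_mem Q').2 hb')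
  have hlt : Q < P := hQQ'.trans_lt (lt_of_le_of_ne hQP' hne)
  have hQt := (isTIdeal_span_singleton K hb0).of_mem_minimalPrimes hQ
  obtain ⟨I, hI, hIP, haI⟩ := hD.exists_le hP.1.1 ha haP
  obtain ⟨J, hJ, hJQ, -⟩ := hD.exists_le hQ.1.1 hb0 ((Ideal.span_singleton_le_iff_mem Q).1 hQ.1.2)
  have hIQ : ¬ I ≤ Q := fun hIQ => by
    have haQ := algebraMap_mem_coeIdeal.1 (hQt.tClosure_le ((coeIdeal_le_coeIdeal K).2 hIQ) haI)
    exact hlt.not_ge (hP.2 ⟨hQ.1.1, (Ideal.span_singleton_le_iff_mem Q).2 haQ⟩ hlt.le)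
  -- The prime `I.radical` contains `a` and lies in `P`, so it is `P` by minimality.
  have hrad : J ≤ I.radical := by
    have hI1 : I ≠ ⊤ := fun h1 => hP.1.1.ne_top (top_le_iff.1 (h1 ▸ hIP))
    have hradP : I.radical ≤ P := hP.1.1.radical_le_iff.2 hIP
    have har := hI.1.tClosure_le_of_le_prime hPt hP.1.1.ne_top (hI.isPrime_radical hI1) hradP
      Ideal.le_radical haI
    exact (hJQ.trans hlt.le).trans
      (hP.2 ⟨hI.isPrime_radical hI1, (Ideal.span_singleton_le_iff_mem _).2 har⟩ hradP)
  obtain ⟨n, hn⟩ := hJ.1.exists_pow_le hrad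
  obtain ⟨V, hV, hJV⟩ := hJ.exists_tVal
  have hle : ∀ m : ℕ, (J : FractionalIdeal D⁰ K) ≤ tClosure ((I : FractionalIdeal D⁰ K) ^ m) := by
    intro m
    have hIm : TVal V ((I : FractionalIdeal D⁰ K) ^ m) := by
      refine (hJV.pow hV (n * m)).of_le hV (hI.1.pow m) (pow_le_one' coeIdeal_le_one m) ?_
      rw [pow_mul]
      exact (pow_le_pow_left' hn m).trans (tClosure_pow_le _ m)
    -- The other comparison gives `I^m ⊆ J_t ⊆ Q`, hence `I ⊆ Q`.
    refine (hJV.le_total hIm).resolve_right fun hIJ => hIQ ?_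
    have hIJ' := hIJ.trans (hQt.tClosure_le ((coeIdeal_le_coeIdeal K).2 hJQ))
    rw [← coeIdeal_pow, coeIdeal_le_coeIdeal K] at hIJ'
    exact hQ.1.1.le_of_pow_le hIJ'
  -- The hypothesis concerns `t`-ideals, so `I` is replaced by its `t`-closure.
  obtain ⟨T, hT⟩ := exists_coeIdeal_eq_tClosure K I
  have hTP : T ≤ P := (coeIdeal_le_coeIdeal K).1
    (hT.trans_le (hPt.tClosure_le ((coeIdeal_le_coeIdeal K).2 hIP)))
  have hTinv : TInv (T : FractionalIdeal D⁰ K) := by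
    rw [hT]
    exact TInv.of_mul_le (tClosure_mul_inv_le_one _)
      (hI.1.trans (tClosure_mono (mul_le_mul_left (le_tClosure _) _)))
  obtain ⟨j, hj, hj0⟩ := Submodule.exists_mem_ne_zero_of_ne_bot hJ.ne_bot
  have hmem : algebraMap D K j ∈ (⋂ (n : ℕ) (_ : 1 ≤ n),
      (tClosure ((T : FractionalIdeal D⁰ K) ^ n) : Set K)) := by
    refine Set.mem_iInter₂.2 fun m _ => ?_
    rw [hT]
    exact tClosure_mono (pow_le_pow_left' (le_tClosure _) m)
      (hle m (algebraMap_mem_coeIdeal.2 hj))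
  rw [h T (fun h1 => hP.1.1.ne_top (top_le_iff.1 (h1 ▸ hTP)))
    (isTIdeal_of_coe_eq_tClosure hI.ne_bot hT) (isTInvertible_iff.2 hTinv)] at hmem
  exact hj0 (by simpa using hmem)

end Implications

end TVIFD

theorem theorem4p8 {D : Type*} [CommRing D] [IsDomain D]
    {K : Type*} [Field K] [Algebra D K] [IsFractionRing D K]
    (hD : TVIFD.IsTVIFD D K) :
    [ TVIFD.IsGeneralizedKrullDomain D K,
      TVIFD.tDim D K ≤ 1,
      TVIFD.SatisfiesPIT D,
      TVIFD.IsCompletelyIntegrallyClosed D K,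
      ∀ I : Ideal D, I ≠ ⊤ → TVIFD.IsTIdeal K I → TVIFD.IsTInvertible K I →
        (⋂ (n : ℕ) (_ : 1 ≤ n),
          (TVIFD.tClosure
            ((I : FractionalIdeal (nonZeroDivisors D) K) ^ n) : Set K)) = {0} ].TFAE := by
  tfae_have 1 → 2 := fun h => h.2.1
  tfae_have 2 → 3 := TVIFD.satisfiesPIT_of_tDim_le_one
  tfae_have 3 → 1 := hD.isGeneralizedKrullDomain
  tfae_have 3 → 4 := hD.isCompletelyIntegrallyClosed
  tfae_have 4 → 5 := fun h _ => h.iInter_tClosure_pow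
  tfae_have 5 → 3 := hD.satisfiesPIT
  tfae_finish
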